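/- **Setting.** Let $p\in(0,1)$ and $b\in(1/2,1]$ be fixed. Subjects $1,2,\dots$ arrive in pairs; $A$ is the symmetric adjacency matrix of their network with $A_{ii}=1$ and with $A_{ij}=A_{ji}\sim\mathrm{Bernoulli}(p)$ independent for $i<j$ (the Erdős–Rényi model with self-loops), and $A^{(k)}=(A_{ij})_{1\le i,j\le k}$. For treatments $T\in\{0,1\}^{2m}$ of the first $2m$ subjects let $$I_{2m}=\bigl\|A^{(2m)}(\mathbf 1_{2m}-2T)\bigr\|$$ (Euclidean norm), and let $I_{2m+1}=I_{2m}$. The *adaptive pairwise biased-coin design* with biasing probability $b$ assigns $(T_{2m-1},T_{2m})\in\{(0,1),(1,0)\}$ for $m=1,2,\dots$ sequentially. The first pair is assigned by a fair coin. For $m\ge 2$, given $A^{(2m)}$ and $T_1,\dots,T_{2m-2}$, let $I_{2m}^{(0,1)}$ and $I_{2m}^{(1,0)}$ be the values that $I_{2m}$ takes for the two possible choices of $(T_{2m-1},T_{2m})$; then $(T_{2m-1},T_{2m})=(0,1)$ with probability $b$ if $I_{2m}^{(0,1)}<I_{2m}^{(1,0)}$, with probability $1-b$ if $I_{2m}^{(0,1)}>I_{2m}^{(1,0)}$,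 and with probability $1/2$ if they are equal; otherwise $(T_{2m-1},T_{2m})=(1,0)$. The *random assignment* is the same procedure with $b$ replaced by $1/2$, i.e. each pair is assigned $(0,1)$ or $(1,0)$ by an independent fair coin; its imbalance measurement is denoted $I_n^{\mathrm{rand}}$. **Theorem.** Under the adaptive design with biasing probability $b$, $$\limsup_{n\to\infty}\frac{\mathbb E[I_n^4]}{n^4}\le p^2(1-p)^2-\frac18(2b-1)\bigl(2-\sqrt2(2b-1)\bigr)^{3/2}p^{5/2}(1-p)^{5/2}.$$ Moreover the design strictly beats random assignment in second moment: $$\limsup_{n\to\infty}\frac{\mathbb E[I_n^2]}{n^2}<p(1-p)=\lim_{n\to\infty}\frac{\mathbb E[(I_n^{\mathrm{rand}})^2]}{n^2}.$$ -/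

import Mathlib

open MeasureTheory Filter Topology
open scoped Matrix

namespace AdaptiveNetwork

noncomputable section

open Classical in
/-- The adjacency matrix of a network on the subjects `0, …, k - 1`, with all self loops present:
ones on the diagonal, and off the diagonal the adjacency matrix of the graph `G`. -/
def networkMatrix {k : ℕ} (G : SimpleGraph (Fin k)) : Matrix (Fin k) (Fin k) ℝ :=
  1 + G.adjMatrix ℝ

/-- The imbalance measurement `‖A (1 - 2 T)‖` (Euclidean norm) of the treatment assignment
`T ∈ {0, 1}^k` on the network `G`, where `A` is the adjacency matrix with self loops. -/
def imbalance {k : ℕ} (G : SimpleGraph (Fin k)) (T : Fin k → Fin 2) : ℝ :=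
  ‖WithLp.toLp 2 (networkMatrix G *ᵥ fun i => 1 - 2 * ((T i : ℕ) : ℝ))‖

/-- The probability one half. -/
def half : unitInterval := ⟨1 / 2, by norm_num, by norm_num⟩

/-- A coin showing `true` with probability `q` and `false` with probability `1 - q`. -/
def coin (q : unitInterval) : PMF Bool :=
  PMF.ofFintype (fun c => ENNReal.ofReal (if c then (q : ℝ) else 1 - (q : ℝ))) (by
    rw [Fintype.sum_bool, ← ENNReal.ofReal_add (by simpa using q.2.1) (by simpa using q.2.2)]
    simp)

/-- The probability with which the next two subjects receive the treatments `(0, 1)`, when `m`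
pairs have already received the treatments `T` and `G` is the network on the first `m + 1` pairs.
The first pair is assigned by a fair coin. Afterwards, the pair of treatments which gives the
smaller imbalance has probability `b`, and a tie is broken by a fair coin. -/
def probZeroOne (b : unitInterval) {m : ℕ} (G : SimpleGraph (Fin (2 * m + 2)))
    (T : Fin (2 * m) → Fin 2) : unitInterval :=
  open Classical in
  if m = 0 then half
  else if imbalance G (Fin.append T ![0, 1]) < imbalance G (Fin.append T ![1, 0]) then b
  else if imbalance G (Fin.append T ![0, 1]) > imbalance G (Fin.append T ![1, 0]) then
    unitInterval.symm b
  else half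

/-- The adaptive pairwise biased coin design with biasing probability `b`: the conditional law,
given the network `G` on the first `m` pairs of subjects, of their treatments. The treatments of
the first `m` pairs are assigned from the subnetwork on these pairs only; then subjects number
`2 m + 1` and `2 m + 2` join, and receive the treatments `(0, 1)` or `(1, 0)`. -/
def design (b : unitInterval) : (m : ℕ) → SimpleGraph (Fin (2 * m)) → PMF (Fin (2 * m) → Fin 2)
  | 0, _ => PMF.pure fun _ => 0
  | m + 1, G =>
    (design b m (SimpleGraph.comap (Fin.castAdd 2 : Fin (2 * m) → Fin (2 * m + 2)) G)).bind
      fun T => (coin (probZeroOne b (m := m) G T)).map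
        fun c => Fin.append T (if c then ![0, 1] else ![1, 0])

/-- The `r`-th moment `E[I_n ^ r]` of the imbalance measurement `I_n`, when the network is an
Erdős–Rényi (binomial) random graph with edge probability `p` and the treatments are assigned by
the design with biasing probability `b`. For odd `n`, `I_n` is by convention `I_{n-1}`, so that in
all cases the first `n / 2` (rounded down) pairs of subjects are used. -/
def imbalanceMoment (p b : unitInterval) (r n : ℕ) : ℝ :=
  ∫ G : SimpleGraph (Fin (2 * (n / 2))),
    (∫ T, imbalance G T ^ r ∂(design b (n / 2) G).toMeasure)
    ∂SimpleGraph.binomialRandom (Fin (2 * (n / 2))) p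

end

end AdaptiveNetwork

namespace AdaptiveNetwork

noncomputable section

/-! ### Expectations over independent coordinates -/

/-! Write q = p(1-p), β = 2b-1, and X for the imbalance after m pairs. Adding a pair with sign ε =
±1 changes X² by 2ε·`crossTerm` + `commonTerm`, and only the first summand depends on the
assignment. The biased coin turns the average of ε·`crossTerm` into -β·|`crossTerm`|, so X² loses
2β·`drift` in conditional mean. Since treatments are balanced, `commonTerm` has mean 8qm + 2(1-p).

Without bias, E X² is therefore 4qm² to leading order, which is the limit q for random assignment.
With bias, E X⁴ grows per step by at most 16qm·E X² - 4β·E[X²·`drift`] up to O(m²), and 16qm·E X² is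
at most 64q²m³ up to O(m²). It remains to bound E[X²·`drift`] from below by a multiple of m³.

Given the past, `crossTerm` is a sum of independent centred variables with coefficient vector of
norm about X. A Khinchine inequality gives `drift` ≥ (5/4)q(X - √(2m)), so E X³ is what matters
(`le_designExp_sq_mul_drift`). By a tangent-line form of Jensen it is bounded below through E X².
Finally E X² cannot be small: Cauchy–Schwarz keeps the mean drift below about 2√2·qm, whence E X² ≥
(3/2)(2-√2β)q·m² eventually (`le_pairMoment_two`).

The increment of E X⁴ is then at most 4(16q² - 2·`gain`)m³ (`pairMoment_four_succ_le_gain`). Summing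
and putting m = n/2 gives q² - `gain`/8. The strict second-moment bound follows from (E X²)² ≤ E X⁴.
-/

/-- The expectation of `f` over `k` independent coordinates, each with weights `w`. -/
def prodExp {α : Type*} [Fintype α] (w : α → ℝ) (k : ℕ) (f : (Fin k → α) → ℝ) : ℝ :=
  ∑ ω, (∏ i, w (ω i)) * f ω

section prodExp

variable {α : Type*} [Fintype α] {w : α → ℝ} {k : ℕ} {f g : (Fin k → α) → ℝ}

/-- Independence enters through this splitting: the moments below are computed by peeling off one
coordinate at a time. -/
lemma prodExp_succ (f : (Fin (k + 1) → α) → ℝ) :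
    prodExp w (k + 1) f = ∑ a, w a * prodExp w k fun ω => f (Fin.cons a ω) := by
  unfold prodExp
  rw [← (Fin.consEquiv fun _ : Fin (k + 1) => α).sum_comp, Fintype.sum_prod_type]
  refine Finset.sum_congr rfl fun a _ => ?_
  rw [Finset.mul_sum]
  refine Finset.sum_congr rfl fun ω _ => ?_
  simp only [Fin.prod_univ_succ, Fin.consEquiv_apply, Fin.cons_zero, Fin.cons_succ, mul_assoc]
  rfl

lemma prodExp_add (f g : (Fin k → α) → ℝ) :
    prodExp w k (fun ω => f ω + g ω) = prodExp w k f + prodExp w k g := by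
  simp [prodExp, mul_add, Finset.sum_add_distrib]

lemma prodExp_const_mul (c : ℝ) (f : (Fin k → α) → ℝ) :
    prodExp w k (fun ω => c * f ω) = c * prodExp w k f := by
  simp only [prodExp, Finset.mul_sum]
  exact Finset.sum_congr rfl fun ω _ => by ring

lemma prodExp_sum {ι : Type*} (s : Finset ι) (f : ι → (Fin k → α) → ℝ) :
    prodExp w k (fun ω => ∑ i ∈ s, f i ω) = ∑ i ∈ s, prodExp w k (f i) := by
  simp only [prodExp, Finset.mul_sum]
  exact Finset.sum_comm

lemma prodExp_mono (hw : ∀ a, 0 ≤ w a) (h : ∀ ω, f ω ≤ g ω) : prodExp w k f ≤ prodExp w k g :=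
  Finset.sum_le_sum fun ω _ =>
    mul_le_mul_of_nonneg_left (h ω) (Finset.prod_nonneg fun i _ => hw (ω i))

lemma prodExp_one (h1 : ∑ a, w a = 1) : prodExp w k (fun _ => 1) = 1 := by
  induction k with
  | zero => simp [prodExp]
  | succ k ih => rw [prodExp_succ]; simp [ih, h1]

lemma prodExp_const (h1 : ∑ a, w a = 1) (c : ℝ) : prodExp w k (fun _ => c) = c := by
  simpa [prodExp_one h1] using prodExp_const_mul (w := w) (k := k) c fun _ => 1

lemma prodExp_sum_apply (h1 : ∑ a, w a = 1) (h : α → ℝ) :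
    prodExp w k (fun ω => ∑ i, h (ω i)) = k * ∑ a, w a * h a := by
  induction k with
  | zero => simp [prodExp]
  | succ k ih =>
    simp only [prodExp_succ, Fin.sum_univ_succ, Fin.cons_zero, Fin.cons_succ, prodExp_add, ih,
      prodExp_const h1, mul_add, Finset.sum_add_distrib, ← Finset.sum_mul, h1]
    push_cast
    ring

variable {ξ : α → ℝ} {v : ℝ}

lemma prodExp_linear (h1 : ∑ a, w a = 1) (h0 : ∑ a, w a * ξ a = 0) (c : Fin k → ℝ) :
    prodExp w k (fun ω => ∑ i, c i * ξ (ω i)) = 0 := by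
  induction k with
  | zero => simp [prodExp]
  | succ k ih =>
    simp only [prodExp_succ, Fin.sum_univ_succ, Fin.cons_zero, Fin.cons_succ, prodExp_add, ih,
      prodExp_const h1, add_zero]
    simp only [mul_left_comm _ (c 0), ← Finset.mul_sum, h0, mul_zero]

lemma prodExp_linear_sq (h1 : ∑ a, w a = 1) (h0 : ∑ a, w a * ξ a = 0)
    (h2 : ∑ a, w a * ξ a ^ 2 = v) (c : Fin k → ℝ) :
    prodExp w k (fun ω => (∑ i, c i * ξ (ω i)) ^ 2) = v * ∑ i, c i ^ 2 := by
  induction k with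
  | zero => simp [prodExp]
  | succ k ih =>
    have key (a : α) : prodExp w k (fun ω => (c 0 * ξ a + ∑ i : Fin k, c i.succ * ξ (ω i)) ^ 2) =
        c 0 ^ 2 * ξ a ^ 2 + v * ∑ i : Fin k, c i.succ ^ 2 := by
      have : (fun ω : Fin k → α => (c 0 * ξ a + ∑ i : Fin k, c i.succ * ξ (ω i)) ^ 2) =
          fun ω => (c 0 ^ 2 * ξ a ^ 2 + (2 * c 0 * ξ a) * ∑ i : Fin k, c i.succ * ξ (ω i)) +
            (∑ i : Fin k, c i.succ * ξ (ω i)) ^ 2 := by ext; ring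
      rw [this, prodExp_add, prodExp_add, prodExp_const h1, prodExp_const_mul,
        prodExp_linear h1 h0, ih]
      ring
    simp only [prodExp_succ, Fin.sum_univ_succ, Fin.cons_zero, Fin.cons_succ, key]
    simp only [mul_add, mul_left_comm _ (c 0 ^ 2), Finset.sum_add_distrib, ← Finset.mul_sum, h2,
      ← Finset.sum_mul, h1]
    ring

/-- In the expansion of (c₀ξ + S)⁴ the terms of odd degree in ξ vanish, as both ξ and S are centred.
The induction closes because the mixed term 6v²c₀²W is at most 3v·c₀²W, which is where v ≤ 1/2
enters. -/
lemma prodExp_linear_pow_four (hw : ∀ a, 0 ≤ w a) (h1 : ∑ a, w a = 1)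
    (h0 : ∑ a, w a * ξ a = 0) (h2 : ∑ a, w a * ξ a ^ 2 = v) (h4 : ∑ a, w a * ξ a ^ 4 ≤ v)
    (hv : v ≤ 1 / 2) (c : Fin k → ℝ) :
    prodExp w k (fun ω => (∑ i, c i * ξ (ω i)) ^ 4) ≤ 3 / 2 * v * (∑ i, c i ^ 2) ^ 2 := by
  have hv0 : 0 ≤ v := h2 ▸ Finset.sum_nonneg fun a _ => mul_nonneg (hw a) (sq_nonneg _)
  induction k with
  | zero => simp [prodExp]
  | succ k ih =>
    set S : (Fin k → α) → ℝ := fun ω => ∑ i : Fin k, c i.succ * ξ (ω i) with hS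
    set W : ℝ := ∑ i : Fin k, c i.succ ^ 2 with hW
    have hW0 : 0 ≤ W := Finset.sum_nonneg fun i _ => sq_nonneg _
    have key (a : α) : prodExp w k (fun ω => (c 0 * ξ a + S ω) ^ 4) =
        c 0 ^ 4 * ξ a ^ 4 + 6 * c 0 ^ 2 * ξ a ^ 2 * (v * W) +
          4 * c 0 * ξ a * prodExp w k (fun ω => S ω ^ 3) + prodExp w k (fun ω => S ω ^ 4) := by
      have : (fun ω => (c 0 * ξ a + S ω) ^ 4) =
          fun ω => (((c 0 ^ 4 * ξ a ^ 4 + (4 * c 0 ^ 3 * ξ a ^ 3) * S ω) +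
            (6 * c 0 ^ 2 * ξ a ^ 2) * S ω ^ 2) + (4 * c 0 * ξ a) * S ω ^ 3) + S ω ^ 4 := by
        ext; ring
      have l1 : prodExp w k S = 0 := prodExp_linear h1 h0 _
      have l2 : prodExp w k (fun ω => S ω ^ 2) = v * W := prodExp_linear_sq h1 h0 h2 _
      rw [this, prodExp_add, prodExp_add, prodExp_add, prodExp_add, prodExp_const h1,
        prodExp_const_mul _ S, l1, prodExp_const_mul _ fun ω => S ω ^ 2, l2, prodExp_const_mul]
      ring
    have total : prodExp w (k + 1) (fun ω => (∑ i, c i * ξ (ω i)) ^ 4) =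
        c 0 ^ 4 * ∑ a, w a * ξ a ^ 4 + 6 * c 0 ^ 2 * v * (v * W) +
          prodExp w k (fun ω => S ω ^ 4) := by
      simp only [prodExp_succ, Fin.sum_univ_succ, Fin.cons_zero, Fin.cons_succ]
      rw [Finset.sum_congr rfl fun a _ => by rw [key a]]
      have : ∀ a, w a * (c 0 ^ 4 * ξ a ^ 4 + 6 * c 0 ^ 2 * ξ a ^ 2 * (v * W) +
          4 * c 0 * ξ a * prodExp w k (fun ω => S ω ^ 3) + prodExp w k (fun ω => S ω ^ 4)) =
          c 0 ^ 4 * (w a * ξ a ^ 4) + (6 * c 0 ^ 2 * (v * W)) * (w a * ξ a ^ 2) +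
          (4 * c 0 * prodExp w k (fun ω => S ω ^ 3)) * (w a * ξ a) +
          prodExp w k (fun ω => S ω ^ 4) * w a := fun a => by ring
      simp only [this, Finset.sum_add_distrib, ← Finset.mul_sum, h0, h1, h2]
      ring
    rw [total, Fin.sum_univ_succ, ← hW]
    have hi := ih fun i => c i.succ
    have e1 : c 0 ^ 4 * ∑ a, w a * ξ a ^ 4 ≤ c 0 ^ 4 * v := by gcongr
    have e2 : 0 ≤ c 0 ^ 2 * W * v * (1 / 2 - v) := by
      have := sub_nonneg.2 hv
      positivity
    have e3 : 0 ≤ c 0 ^ 4 * v := by positivity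
    nlinarith

/-- A Khinchine type inequality, from the second and the fourth moment. -/
lemma le_prodExp_abs_linear (hw : ∀ a, 0 ≤ w a) (h1 : ∑ a, w a = 1)
    (h0 : ∑ a, w a * ξ a = 0) (h2 : ∑ a, w a * ξ a ^ 2 = v) (h4 : ∑ a, w a * ξ a ^ 4 ≤ v)
    (hv : v ≤ 1 / 2) (c : Fin k → ℝ) :
    5 / 8 * v * √(∑ i, c i ^ 2) ≤ prodExp w k fun ω => |∑ i, c i * ξ (ω i)| := by
  set r := √(∑ i, c i ^ 2) with hr
  have hr0 : 0 ≤ r := Real.sqrt_nonneg _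
  have hrr : r ^ 2 = ∑ i, c i ^ 2 := Real.sq_sqrt (Finset.sum_nonneg fun i _ => sq_nonneg _)
  rcases hr0.eq_or_lt with h | hpos
  · rw [← h, mul_zero]
    simpa [prodExp] using Finset.sum_nonneg fun ω _ =>
      mul_nonneg (Finset.prod_nonneg fun i _ => hw (ω i)) (abs_nonneg (∑ i, c i * ξ (ω i)))
  -- With y = |z|/r this says y - y³/4 ≤ 1. In expectation the left side is at least vr -
  -- (1/4)(3/2)vr = (5/8)vr.
  have tangent (z : ℝ) : 1 / r * z ^ 2 + -(1 / (4 * r ^ 3)) * z ^ 4 ≤ |z| := by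
    have : 1 / r * z ^ 2 + -(1 / (4 * r ^ 3)) * z ^ 4 =
        (|z| * (r * |z| * (4 * r ^ 2 - |z| ^ 2))) / (4 * r ^ 4) := by
      rw [show z ^ 4 = |z| ^ 4 by rw [show 4 = 2 * 2 from rfl, pow_mul, pow_mul, sq_abs],
        ← sq_abs z]
      field_simp
      ring
    rw [this, div_le_iff₀ (by positivity)]
    refine mul_le_mul_of_nonneg_left ?_ (abs_nonneg z)
    have hz := abs_nonneg z
    set y := |z|
    nlinarith [mul_nonneg (add_nonneg hz hr0) (mul_nonneg hr0 (sq_nonneg (y - r))),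
      mul_nonneg hr0 (mul_nonneg hr0 (sq_nonneg (y - r))),
      mul_nonneg hr0 (mul_nonneg hz (sq_nonneg (y - r))),
      mul_nonneg hr0 (mul_nonneg hr0 (sq_nonneg (3*y - 4*r))), pow_nonneg hr0 4]
  refine le_trans ?_ (prodExp_mono hw fun ω => tangent (∑ i, c i * ξ (ω i)))
  rw [prodExp_add, prodExp_const_mul, prodExp_const_mul, prodExp_linear_sq h1 h0 h2, ← hrr]
  have h := prodExp_linear_pow_four hw h1 h0 h2 h4 hv c
  rw [← hrr] at h
  have h' := mul_le_mul_of_nonneg_left h (show 0 ≤ 1 / (4 * r ^ 3) by positivity)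
  have e1 : 1 / (4 * r ^ 3) * (3 / 2 * v * (r ^ 2) ^ 2) = 3 / 8 * v * r := by field_simp; ring
  have e2 : 1 / r * (v * r ^ 2) = v * r := by field_simp
  rw [e1] at h'
  rw [e2]
  linarith

end prodExp

/-! ### Adding two vertices to a graph -/

/-- The graph obtained from `H` by adding two vertices: `ω i` says to which of them the old vertex
`i` is joined, and `a` whether they are joined to each other. -/
def extendGraph {k : ℕ} (H : SimpleGraph (Fin k)) (ω : Fin k → Bool × Bool) (a : Bool) :
    SimpleGraph (Fin (k + 2)) where
  Adj x y := Fin.addCases (motive := fun _ => Prop)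
    (fun i => Fin.addCases (motive := fun _ => Prop) (fun j => H.Adj i j)
      (fun l => ![(ω i).1, (ω i).2] l = true) y)
    (fun l => Fin.addCases (motive := fun _ => Prop) (fun i => ![(ω i).1, (ω i).2] l = true)
      (fun l' => l ≠ l' ∧ a = true) y) x
  symm := ⟨fun x y => by
    induction x using Fin.addCases <;> induction y using Fin.addCases <;>
      simp +contextual [H.adj_comm, ne_comm]⟩
  loopless := ⟨fun x => by induction x using Fin.addCases <;> simp⟩

section extendGraph

variable {k : ℕ} (H : SimpleGraph (Fin k)) (ω : Fin k → Bool × Bool) (a : Bool)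

@[simp] lemma extendGraph_adj_old (i j : Fin k) :
    (extendGraph H ω a).Adj (Fin.castAdd 2 i) (Fin.castAdd 2 j) ↔ H.Adj i j := by
  simp [extendGraph]

@[simp] lemma extendGraph_adj_old_new (i : Fin k) (l : Fin 2) :
    (extendGraph H ω a).Adj (Fin.castAdd 2 i) (Fin.natAdd k l) ↔
      ![(ω i).1, (ω i).2] l = true := by
  simp [extendGraph]

@[simp] lemma extendGraph_adj_new_old (i : Fin k) (l : Fin 2) :
    (extendGraph H ω a).Adj (Fin.natAdd k l) (Fin.castAdd 2 i) ↔
      ![(ω i).1, (ω i).2] l = true := by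
  simp [extendGraph]

@[simp] lemma extendGraph_adj_new (l l' : Fin 2) :
    (extendGraph H ω a).Adj (Fin.natAdd k l) (Fin.natAdd k l') ↔ l ≠ l' ∧ a = true := by
  simp [extendGraph]

lemma comap_extendGraph : SimpleGraph.comap (Fin.castAdd 2) (extendGraph H ω a) = H := by
  ext i j; simp

end extendGraph

/-- A graph on `k + 2` vertices is the same as a graph on `k` vertices together with the edges at
two additional vertices. -/
def extendEquiv (k : ℕ) :
    SimpleGraph (Fin k) × (Fin k → Bool × Bool) × Bool ≃ SimpleGraph (Fin (k + 2)) :=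
  open Classical in
  { toFun := fun x => extendGraph x.1 x.2.1 x.2.2
    invFun := fun G => (SimpleGraph.comap (Fin.castAdd 2) G,
      fun i => (decide (G.Adj (Fin.castAdd 2 i) (Fin.natAdd k 0)),
        decide (G.Adj (Fin.castAdd 2 i) (Fin.natAdd k 1))),
      decide (G.Adj (Fin.natAdd k 0) (Fin.natAdd k 1)))
    left_inv := fun x => by
      refine Prod.ext (comap_extendGraph _ _ _) (Prod.ext (funext fun i => ?_) ?_) <;> simp
    right_inv := fun G => by
      ext x y
      induction x using Fin.addCases <;> induction y using Fin.addCases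
      · simp
      · rename_i l; fin_cases l <;> simp
      · rename_i l _; fin_cases l <;> simp [G.adj_comm]
      · rename_i l l'; fin_cases l <;> fin_cases l' <;> simp [G.adj_comm] }

/-- The probability of the graph `G` as an Erdős–Rényi graph with edge probability `p`. -/
def graphWeight (p : ℝ) {k : ℕ} (G : SimpleGraph (Fin k)) : ℝ :=
  p ^ G.edgeSet.ncard * (1 - p) ^ (k.choose 2 - G.edgeSet.ncard)

/-- The probability of `c` as the result of a coin showing `true` with probability `p`. -/
def boolWeight (p : ℝ) (c : Bool) : ℝ := if c then p else 1 - p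

/-- The probability of a pair of independent coins. -/
def pairWeight (p : ℝ) (c : Bool × Bool) : ℝ := boolWeight p c.1 * boolWeight p c.2

/-! ### Factorisation of the Erdős–Rényi weight over the added edges -/

open Classical in
lemma two_mul_ncard_edgeSet {k : ℕ} (G : SimpleGraph (Fin k)) :
    2 * G.edgeSet.ncard = ∑ i, ∑ j, if G.Adj i j then 1 else 0 := by
  rw [← SimpleGraph.coe_edgeFinset, Set.ncard_coe_finset, ← G.sum_degrees_eq_twice_card_edges]
  refine Finset.sum_congr rfl fun i _ => ?_
  rw [← SimpleGraph.card_neighborFinset_eq_degree, SimpleGraph.neighborFinset_eq_filter,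
    Finset.card_filter]

lemma ncard_edgeSet_le {k : ℕ} (G : SimpleGraph (Fin k)) : G.edgeSet.ncard ≤ k.choose 2 := by
  classical
  rw [← SimpleGraph.coe_edgeFinset, Set.ncard_coe_finset]
  simpa using G.card_edgeFinset_le_card_choose_two

lemma ncard_edgeSet_extendGraph {k : ℕ} (H : SimpleGraph (Fin k)) (ω : Fin k → Bool × Bool)
    (a : Bool) : (extendGraph H ω a).edgeSet.ncard = H.edgeSet.ncard +
      (Finset.univ.filter fun i => (ω i).1 = true).card +
      (Finset.univ.filter fun i => (ω i).2 = true).card + if a then 1 else 0 := by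
  classical
  have h := two_mul_ncard_edgeSet (extendGraph H ω a)
  have h' := two_mul_ncard_edgeSet H
  simp only [Fin.sum_univ_add, extendGraph_adj_old, extendGraph_adj_old_new,
    extendGraph_adj_new_old, extendGraph_adj_new, Finset.sum_add_distrib, Fin.sum_univ_two] at h
  rw [← h'] at h
  simp only [Finset.card_filter]
  simp [-Finset.sum_boole] at h
  change _ = 2 * _ + ((∑ x, if (ω x).1 = true then 1 else 0) +
    ∑ x, if (ω x).2 = true then 1 else 0) + (((∑ x, if (ω x).1 = true then 1 else 0) + _) + _) at h
  omega

lemma prod_boolWeight (p : ℝ) {k : ℕ} (c : Fin k → Bool) :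
    ∏ i, boolWeight p (c i) = p ^ (Finset.univ.filter fun i => c i = true).card *
      (1 - p) ^ (k - (Finset.univ.filter fun i => c i = true).card) := by
  have h := Finset.card_filter_add_card_filter_not (s := (Finset.univ : Finset (Fin k)))
    (fun i => c i = true)
  rw [Finset.card_univ, Fintype.card_fin] at h
  simp only [boolWeight, Finset.prod_ite, Finset.prod_const]
  congr 2
  omega

/-- The two new vertices bring 2k + 1 new edge slots, each an independent Bernoulli(p) variable. -/
lemma graphWeight_extendGraph (p : ℝ) {k : ℕ} (H : SimpleGraph (Fin k))
    (ω : Fin k → Bool × Bool) (a : Bool) :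
    graphWeight p (extendGraph H ω a) =
      graphWeight p H * ((∏ i, pairWeight p (ω i)) * boolWeight p a) := by
  simp only [pairWeight, Finset.prod_mul_distrib]
  rw [prod_boolWeight p fun i => (ω i).1, prod_boolWeight p fun i => (ω i).2, graphWeight,
    graphWeight, ncard_edgeSet_extendGraph]
  have h0 := ncard_edgeSet_le H
  have h1 : (Finset.univ.filter fun i => (ω i).1 = true).card ≤ k := by
    simpa using Finset.card_le_univ (Finset.univ.filter fun i => (ω i).1 = true)
  have h2 : (Finset.univ.filter fun i => (ω i).2 = true).card ≤ k := by
    simpa using Finset.card_le_univ (Finset.univ.filter fun i => (ω i).2 = true)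
  have hc : (k + 2).choose 2 = k.choose 2 + 2 * k + 1 := by
    simp [Nat.choose_succ_succ', Nat.choose_one_right]; omega
  generalize (Finset.univ.filter fun i => (ω i).1 = true).card = n1 at *
  generalize (Finset.univ.filter fun i => (ω i).2 = true).card = n2 at *
  generalize H.edgeSet.ncard = n0 at *
  -- The numbers of absent edges replace the truncated subtractions in the exponents.
  obtain ⟨r0, hr0⟩ := Nat.exists_eq_add_of_le h0
  obtain ⟨r1, hr1⟩ := Nat.exists_eq_add_of_le h1
  obtain ⟨r2, hr2⟩ := Nat.exists_eq_add_of_le h2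
  have e1 : k - n1 = r1 := by omega
  have e2 : k - n2 = r2 := by omega
  have e0 : k.choose 2 - n0 = r0 := by omega
  rw [e0, e1, e2, hc]
  cases a
  · have e : k.choose 2 + 2 * k + 1 - (n0 + n1 + n2 + if false = true then 1 else 0) =
      r0 + r1 + r2 + 1 := by simp; omega
    rw [e]
    simp [boolWeight]
    ring
  · have e : k.choose 2 + 2 * k + 1 - (n0 + n1 + n2 + if true = true then 1 else 0) =
      r0 + r1 + r2 := by simp; omega
    rw [e]
    simp [boolWeight]
    ring

open Classical in
lemma sum_graphWeight_succ (p : ℝ) {k : ℕ} (F : SimpleGraph (Fin (k + 2)) → ℝ) :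
    ∑ G, graphWeight p G * F G = ∑ H : SimpleGraph (Fin k), graphWeight p H *
      prodExp (pairWeight p) k fun ω => ∑ a, boolWeight p a * F (extendGraph H ω a) := by
  rw [← (extendEquiv k).sum_comp, Fintype.sum_prod_type]
  refine Finset.sum_congr rfl fun H _ => ?_
  rw [Fintype.sum_prod_type, prodExp, Finset.mul_sum]
  refine Finset.sum_congr rfl fun ω _ => ?_
  rw [Finset.mul_sum, Finset.mul_sum]
  refine Finset.sum_congr rfl fun a _ => ?_
  change graphWeight p (extendGraph H ω a) * F (extendGraph H ω a) = _
  rw [graphWeight_extendGraph]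
  ring

open Classical in
lemma integral_binomialRandom (p : unitInterval) {k : ℕ} (F : SimpleGraph (Fin k) → ℝ) :
    ∫ G, F G ∂SimpleGraph.binomialRandom (Fin k) p = ∑ G, graphWeight p G * F G := by
  have : MeasurableSingletonClass (SimpleGraph (Fin k)) := ⟨fun G => by
    have h : ({G} : Set (SimpleGraph (Fin k))) = SimpleGraph.edgeSet ⁻¹' {G.edgeSet} := by
      ext G'; simp
    rw [h]
    exact SimpleGraph.measurable_edgeSet (measurableSet_singleton _)⟩
  rw [integral_fintype .of_finite]
  refine Finset.sum_congr rfl fun G _ => ?_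
  simp [measureReal_def, graphWeight]

/-! ### Expectations of finite random variables -/

/-- The expectation of `f` under the law `μ`. -/
def pmfExp {α : Type*} [Fintype α] (μ : PMF α) (f : α → ℝ) : ℝ := ∑ x, (μ x).toReal * f x

section pmfExp

variable {α β : Type*} [Fintype α] [Fintype β]

lemma integral_toMeasure [MeasurableSpace α] [MeasurableSingletonClass α] (μ : PMF α)
    (f : α → ℝ) : ∫ x, f x ∂μ.toMeasure = pmfExp μ f := by
  simp [PMF.integral_eq_sum, pmfExp]

lemma pmfExp_pure (x : α) (f : α → ℝ) : pmfExp (PMF.pure x) f = f x := by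
  classical
  rw [pmfExp, Finset.sum_eq_single x] <;> simp +contextual [PMF.pure_apply]

lemma pmfExp_bind (μ : PMF α) (ν : α → PMF β) (f : β → ℝ) :
    pmfExp (μ.bind ν) f = pmfExp μ fun x => pmfExp (ν x) f := by
  simp only [pmfExp, PMF.bind_apply, tsum_fintype, Finset.mul_sum]
  rw [Finset.sum_comm]
  refine Finset.sum_congr rfl fun y _ => ?_
  rw [ENNReal.toReal_sum fun x _ =>
    ENNReal.mul_ne_top (PMF.apply_ne_top _ _) (PMF.apply_ne_top _ _), Finset.sum_mul]
  exact Finset.sum_congr rfl fun x _ => by rw [ENNReal.toReal_mul, mul_assoc]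

lemma pmfExp_map (μ : PMF α) (g : α → β) (f : β → ℝ) :
    pmfExp (μ.map g) f = pmfExp μ fun x => f (g x) := by
  rw [PMF.map, pmfExp_bind]
  simp [pmfExp_pure]

lemma pmfExp_coin (q : unitInterval) (f : Bool → ℝ) :
    pmfExp (coin q) f = (q : ℝ) * f true + (1 - (q : ℝ)) * f false := by
  simp [pmfExp, coin, ENNReal.toReal_ofReal q.2.1, ENNReal.toReal_ofReal (sub_nonneg.2 q.2.2)]

end pmfExp

open Classical in
/-- The expectation of `F G T` for the random network `G` on `m` pairs and the treatments `T`
assigned by the design. -/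
def designExp (p b : unitInterval) (m : ℕ)
    (F : SimpleGraph (Fin (2 * m)) → (Fin (2 * m) → Fin 2) → ℝ) : ℝ :=
  ∑ G, graphWeight p G * pmfExp (design b m G) (F G)

lemma imbalanceMoment_eq (p b : unitInterval) (r n : ℕ) :
    imbalanceMoment p b r n = designExp p b (n / 2) fun G T => imbalance G T ^ r := by
  rw [imbalanceMoment, integral_binomialRandom]
  simp only [integral_toMeasure]
  rfl

/-- The conditional expectation, given the network and the treatments of the first `m` pairs, after
the next pair has been added. -/
def stepExp (p b : unitInterval) (m : ℕ)
    (F : SimpleGraph (Fin (2 * m + 2)) → (Fin (2 * m + 2) → Fin 2) → ℝ)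
    (H : SimpleGraph (Fin (2 * m))) (T : Fin (2 * m) → Fin 2) : ℝ :=
  prodExp (pairWeight p) (2 * m) fun ω => ∑ a, boolWeight p a *
    ((probZeroOne b (extendGraph H ω a) T : ℝ) * F (extendGraph H ω a) (Fin.append T ![0, 1]) +
      (1 - (probZeroOne b (extendGraph H ω a) T : ℝ)) *
        F (extendGraph H ω a) (Fin.append T ![1, 0]))

/-- By `comap_extendGraph` the earlier treatments depend on the extended graph only through `H`.
Given `H` they are independent of the new edges, so the new edges and the coin can be averaged out
first. -/
lemma designExp_succ (p b : unitInterval) (m : ℕ)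
    (F : SimpleGraph (Fin (2 * m + 2)) → (Fin (2 * m + 2) → Fin 2) → ℝ) :
    designExp p b (m + 1) F = designExp p b m (stepExp p b m F) := by
  unfold designExp
  refine (sum_graphWeight_succ (k := 2 * m) (p : ℝ)
    fun G => pmfExp (design b (m + 1) G) (F G)).trans ?_
  refine Finset.sum_congr rfl fun H _ => congrArg _ ?_
  have h (ω : Fin (2 * m) → Bool × Bool) (a : Bool) :
      pmfExp (design b (m + 1) (extendGraph H ω a)) (F (extendGraph H ω a)) =
      pmfExp (design b m H) fun T =>
        ((probZeroOne b (extendGraph H ω a) T : ℝ) * F (extendGraph H ω a) (Fin.append T ![0, 1]) +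
      (1 - (probZeroOne b (extendGraph H ω a) T : ℝ)) *
        F (extendGraph H ω a) (Fin.append T ![1, 0])) := by
    rw [design]
    refine (pmfExp_bind _ _ _).trans ?_
    rw [comap_extendGraph]
    refine congrArg _ (funext fun T => ?_)
    rw [pmfExp_map, pmfExp_coin]
    simp
  simp only [h]
  simp only [pmfExp, stepExp]
  rw [← Finset.sum_congr rfl fun T _ => prodExp_const_mul _ _, ← prodExp_sum]
  refine congrArg _ (funext fun ω => ?_)
  simp only [Finset.mul_sum]
  rw [Finset.sum_comm]
  refine Finset.sum_congr rfl fun T _ => Finset.sum_congr rfl fun a _ => by ring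

/-! ### The imbalance after one more pair -/

/-- The sign `1 - 2 t` of a treatment `t`. -/
def sgn (t : Fin 2) : ℝ := 1 - 2 * ((t : ℕ) : ℝ)

@[simp] lemma sgn_zero : sgn 0 = 1 := by simp [sgn]

@[simp] lemma sgn_one : sgn 1 = -1 := by norm_num [sgn]

lemma sgn_sq (t : Fin 2) : sgn t ^ 2 = 1 := by fin_cases t <;> simp [sgn_zero, sgn_one]

/-- The real number `0` or `1` corresponding to a Boolean. -/
def ind (a : Bool) : ℝ := if a then 1 else 0

@[simp] lemma ind_true : ind true = 1 := rfl

@[simp] lemma ind_false : ind false = 0 := rfl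

/-- The imbalance vector `A (1 - 2 T)`. -/
def imbalanceVec {k : ℕ} (G : SimpleGraph (Fin k)) (T : Fin k → Fin 2) : Fin k → ℝ :=
  networkMatrix G *ᵥ fun i => sgn (T i)

lemma imbalance_sq {k : ℕ} (G : SimpleGraph (Fin k)) (T : Fin k → Fin 2) :
    imbalance G T ^ 2 = ∑ i, imbalanceVec G T i ^ 2 := by
  rw [imbalance, EuclideanSpace.norm_sq_eq]
  simp [imbalanceVec, sgn]

lemma imbalance_nonneg {k : ℕ} (G : SimpleGraph (Fin k)) (T : Fin k → Fin 2) :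
    0 ≤ imbalance G T := norm_nonneg _

open Classical in
lemma imbalanceVec_apply {k : ℕ} (G : SimpleGraph (Fin k)) (T : Fin k → Fin 2) (i : Fin k) :
    imbalanceVec G T i = sgn (T i) + ∑ j, if G.Adj i j then sgn (T j) else 0 := by
  rw [imbalanceVec, networkMatrix, Matrix.add_mulVec, Matrix.one_mulVec]
  simp [Matrix.mulVec, dotProduct, SimpleGraph.adjMatrix_apply]

section step

variable {k : ℕ} (H : SimpleGraph (Fin k)) (T : Fin k → Fin 2) (ω : Fin k → Bool × Bool) (a : Bool)

/-- The coefficient of the linear part of the increment. -/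
def linCoeff (i : Fin k) : ℝ := imbalanceVec H T i + (1 - ind a) * sgn (T i)

/-- Half the difference between the two possible values of the squared imbalance. -/
def crossTerm : ℝ := ∑ i, linCoeff H T a i * (ind (ω i).1 - ind (ω i).2)

/-- The part of the increment of the squared imbalance that does not depend on the next
treatments. -/
def commonTerm : ℝ :=
  ∑ i, (ind (ω i).1 - ind (ω i).2) ^ 2 + (∑ i, sgn (T i) * ind (ω i).1) ^ 2 +
    (∑ i, sgn (T i) * ind (ω i).2) ^ 2 + 2 * (1 - ind a) ^ 2

/-- An old entry of the imbalance vector shifts by ε times the difference of its two new edges. The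
new entries are U + ε(1-a) and V - ε(1-a), the self-loop giving 1 and the edge inside the pair -a.
After squaring, ε² = 1 leaves only an affine dependence on ε. -/
lemma imbalance_extend_sq (τ : Fin 2 → Fin 2) (ε : ℝ) (h0 : sgn (τ 0) = ε) (h1 : sgn (τ 1) = -ε)
    (hε : ε ^ 2 = 1) :
    imbalance (extendGraph H ω a) (Fin.append T τ) ^ 2 =
      imbalance H T ^ 2 + 2 * ε * crossTerm H T ω a + commonTerm T ω a := by
  classical
  have hold (i : Fin k) : imbalanceVec (extendGraph H ω a) (Fin.append T τ) (Fin.castAdd 2 i) =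
      imbalanceVec H T i + ε * (ind (ω i).1 - ind (ω i).2) := by
    simp only [imbalanceVec_apply, Fin.sum_univ_add, Fin.append_left, Fin.append_right,
      extendGraph_adj_old, extendGraph_adj_old_new, Fin.sum_univ_two, h0, h1]
    rcases ω i with ⟨_ | _, _ | _⟩ <;> simp [add_assoc]
  have hnew0 : imbalanceVec (extendGraph H ω a) (Fin.append T τ) (Fin.natAdd k 0) =
      ∑ i, sgn (T i) * ind (ω i).1 + ε * (1 - ind a) := by
    simp only [imbalanceVec_apply, Fin.sum_univ_add, Fin.append_left, Fin.append_right,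
      extendGraph_adj_new_old, extendGraph_adj_new, Fin.sum_univ_two, h0, h1]
    have : (∑ i, if ![(ω i).1, (ω i).2] 0 = true then sgn (T i) else 0) =
        ∑ i, sgn (T i) * ind (ω i).1 := by
      refine Finset.sum_congr rfl fun i _ => ?_
      rcases ω i with ⟨_ | _, _ | _⟩ <;> simp
    rw [this]
    cases a <;> simp
    ring
  have hnew1 : imbalanceVec (extendGraph H ω a) (Fin.append T τ) (Fin.natAdd k 1) =
      ∑ i, sgn (T i) * ind (ω i).2 - ε * (1 - ind a) := by
    simp only [imbalanceVec_apply, Fin.sum_univ_add, Fin.append_left, Fin.append_right,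
      extendGraph_adj_new_old, extendGraph_adj_new, Fin.sum_univ_two, h0, h1]
    have : (∑ i, if ![(ω i).1, (ω i).2] 1 = true then sgn (T i) else 0) =
        ∑ i, sgn (T i) * ind (ω i).2 := by
      refine Finset.sum_congr rfl fun i _ => ?_
      rcases ω i with ⟨_ | _, _ | _⟩ <;> simp
    rw [this]
    cases a <;> simp
    ring
  rw [imbalance_sq, imbalance_sq, Fin.sum_univ_add, Fin.sum_univ_two, hnew0, hnew1]
  simp only [hold]
  have e1 : ∑ i, (imbalanceVec H T i + ε * (ind (ω i).1 - ind (ω i).2)) ^ 2 =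
      ∑ i, imbalanceVec H T i ^ 2 +
        2 * ε * ∑ i, imbalanceVec H T i * (ind (ω i).1 - ind (ω i).2) +
        ∑ i, (ind (ω i).1 - ind (ω i).2) ^ 2 := by
    rw [Finset.mul_sum, ← Finset.sum_add_distrib, ← Finset.sum_add_distrib]
    refine Finset.sum_congr rfl fun i _ => ?_
    linear_combination (ind (ω i).1 - ind (ω i).2) ^ 2 * hε
  have e2 : crossTerm H T ω a = ∑ i, imbalanceVec H T i * (ind (ω i).1 - ind (ω i).2) +
      (1 - ind a) * (∑ i, sgn (T i) * ind (ω i).1 - ∑ i, sgn (T i) * ind (ω i).2) := by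
    rw [← Finset.sum_sub_distrib, Finset.mul_sum, ← Finset.sum_add_distrib]
    refine Finset.sum_congr rfl fun i _ => ?_
    rw [linCoeff]
    ring
  rw [e1, e2, commonTerm]
  linear_combination 2 * (1 - ind a) ^ 2 * hε

lemma commonTerm_nonneg : 0 ≤ commonTerm T ω a := by
  unfold commonTerm
  have : 0 ≤ ∑ i, (ind (ω i).1 - ind (ω i).2) ^ 2 := Finset.sum_nonneg fun i _ => sq_nonneg _
  positivity

end step

lemma half_coe : (half : ℝ) = 1 / 2 := rfl

/-- Averaging an affine function of the sign over the next treatments. -/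
lemma probZeroOne_average (b : unitInterval) {m : ℕ} (H : SimpleGraph (Fin (2 * m)))
    (T : Fin (2 * m) → Fin 2) (ω : Fin (2 * m) → Bool × Bool) (a : Bool) (u v : ℝ) :
    (probZeroOne b (extendGraph H ω a) T : ℝ) * (u + v * crossTerm H T ω a) +
      (1 - (probZeroOne b (extendGraph H ω a) T : ℝ)) * (u - v * crossTerm H T ω a) =
      u - (2 * (b : ℝ) - 1) * v * |crossTerm H T ω a| := by
  have h01 := imbalance_extend_sq H T ω a ![0, 1] 1 (by simp) (by simp) (by norm_num)
  have h10 := imbalance_extend_sq H T ω a ![1, 0] (-1) (by simp) (by simp) (by norm_num)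
  have n01 := imbalance_nonneg (extendGraph H ω a) (Fin.append T ![0, 1])
  have n10 := imbalance_nonneg (extendGraph H ω a) (Fin.append T ![1, 0])
  unfold probZeroOne
  split_ifs with h1 h2 h3
  -- For the first pair `crossTerm` is an empty sum, so the fair coin also satisfies the formula.
  · subst h1
    have : crossTerm H T ω a = 0 := by simp [crossTerm]
    rw [this, half_coe]
    norm_num
    ring
  -- The two candidate squared imbalances differ by 4·`crossTerm`, whose sign therefore decides the
  -- favoured assignment.
  · have : crossTerm H T ω a < 0 := by nlinarith
    rw [abs_of_neg this]
    ring
  · have : 0 < crossTerm H T ω a := by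
      have h3' : imbalance (extendGraph H ω a) (Fin.append T ![1, 0]) < _ := h3
      nlinarith
    rw [abs_of_pos this, unitInterval.coe_symm_eq]
    ring
  · have h := le_antisymm (not_lt.1 h3) (not_lt.1 h2)
    have : crossTerm H T ω a = 0 := by rw [h] at h01; linarith
    rw [this, half_coe]
    norm_num
    ring

/-- The expectation over the edges at the next two subjects. -/
def edgeExp (p : ℝ) (k : ℕ) (f : (Fin k → Bool × Bool) → Bool → ℝ) : ℝ :=
  prodExp (pairWeight p) k fun ω => ∑ a, boolWeight p a * f ω a

lemma stepExp_imbalance_sq (p b : unitInterval) (m : ℕ) (H : SimpleGraph (Fin (2 * m)))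
    (T : Fin (2 * m) → Fin 2) :
    stepExp p b m (fun G T => imbalance G T ^ 2) H T = edgeExp p (2 * m) fun ω a =>
      imbalance H T ^ 2 + commonTerm T ω a - 2 * (2 * (b : ℝ) - 1) * |crossTerm H T ω a| := by
  unfold stepExp edgeExp
  refine congrArg _ (funext fun ω => Finset.sum_congr rfl fun a _ => congrArg _ ?_)
  have h01 := imbalance_extend_sq H T ω a ![0, 1] 1 (by simp) (by simp) (by norm_num)
  have h10 := imbalance_extend_sq H T ω a ![1, 0] (-1) (by simp) (by simp) (by norm_num)
  beta_reduce
  rw [h01, h10]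
  have h := probZeroOne_average b H T ω a (imbalance H T ^ 2 + commonTerm T ω a) 2
  rw [← sub_eq_zero] at h ⊢
  rw [← h]
  ring

/-- The square of u + 2ε·`crossTerm` is again affine in ε because ε² = 1, so `probZeroOne_average`
applies to the fourth power too. -/
lemma stepExp_imbalance_pow_four (p b : unitInterval) (m : ℕ) (H : SimpleGraph (Fin (2 * m)))
    (T : Fin (2 * m) → Fin 2) :
    stepExp p b m (fun G T => imbalance G T ^ 4) H T = edgeExp p (2 * m) fun ω a =>
      (imbalance H T ^ 2 + commonTerm T ω a) ^ 2 + 4 * crossTerm H T ω a ^ 2 -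
        4 * (2 * (b : ℝ) - 1) * (imbalance H T ^ 2 + commonTerm T ω a) *
          |crossTerm H T ω a| := by
  unfold stepExp edgeExp
  refine congrArg _ (funext fun ω => Finset.sum_congr rfl fun a _ => congrArg _ ?_)
  have h01 := imbalance_extend_sq H T ω a ![0, 1] 1 (by simp) (by simp) (by norm_num)
  have h10 := imbalance_extend_sq H T ω a ![1, 0] (-1) (by simp) (by simp) (by norm_num)
  beta_reduce
  rw [show 4 = 2 * 2 from rfl, pow_mul, pow_mul, h01, h10]
  have h := probZeroOne_average b H T ω a ((imbalance H T ^ 2 + commonTerm T ω a) ^ 2 +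
    4 * crossTerm H T ω a ^ 2) (4 * (imbalance H T ^ 2 + commonTerm T ω a))
  rw [← sub_eq_zero] at h ⊢
  rw [← h]
  ring

/-! ### The treatments are balanced -/

/-- Each pair contributes +1 and -1. Balance lets edge indicators be centred at p for free
(`sum_sgn_mul_sub`), so `commonTerm` has mean of order k and not k². -/
lemma sum_sgn_eq_zero (b : unitInterval) (m : ℕ) (G : SimpleGraph (Fin (2 * m)))
    (T : Fin (2 * m) → Fin 2) (hT : design b m G T ≠ 0) : ∑ i, sgn (T i) = 0 := by
  induction m with
  | zero => simp
  | succ m ih =>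
    rw [← PMF.mem_support_iff, design] at hT
    obtain ⟨T', hT', hc⟩ := (PMF.mem_support_bind_iff _ _ _).1 hT
    obtain ⟨c, -, rfl⟩ := (PMF.mem_support_map_iff _ _ _).1 hc
    have := ih _ T' hT'
    refine (Fin.sum_univ_add (a := 2 * m) (b := 2) _).trans ?_
    cases c <;> simp [this]

section designExp

variable {p b : unitInterval} {m : ℕ}
  {F F' : SimpleGraph (Fin (2 * m)) → (Fin (2 * m) → Fin 2) → ℝ}

lemma graphWeight_nonneg (p : unitInterval) {k : ℕ} (G : SimpleGraph (Fin k)) :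
    0 ≤ graphWeight p G :=
  mul_nonneg (pow_nonneg p.2.1 _) (pow_nonneg (sub_nonneg.2 p.2.2) _)

lemma designExp_mono (h : ∀ G T, ∑ i, sgn (T i) = 0 → F G T ≤ F' G T) :
    designExp p b m F ≤ designExp p b m F' := by
  refine Finset.sum_le_sum fun G _ => mul_le_mul_of_nonneg_left
    (Finset.sum_le_sum fun T _ => ?_) (graphWeight_nonneg p G)
  by_cases hT : design b m G T = 0
  · simp [hT]
  · exact mul_le_mul_of_nonneg_left (h G T (sum_sgn_eq_zero b m G T hT)) ENNReal.toReal_nonneg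

lemma designExp_congr (h : ∀ G T, ∑ i, sgn (T i) = 0 → F G T = F' G T) :
    designExp p b m F = designExp p b m F' :=
  le_antisymm (designExp_mono fun G T hT => (h G T hT).le)
    (designExp_mono fun G T hT => (h G T hT).ge)

lemma designExp_add : designExp p b m (fun G T => F G T + F' G T) =
    designExp p b m F + designExp p b m F' := by
  simp [designExp, pmfExp, mul_add, Finset.sum_add_distrib]

lemma designExp_const_mul (c : ℝ) : designExp p b m (fun G T => c * F G T) =
    c * designExp p b m F := by
  simp only [designExp, pmfExp, Finset.mul_sum]
  exact Finset.sum_congr rfl fun G _ => Finset.sum_congr rfl fun T _ => by ring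

lemma sum_boolWeight (p : ℝ) : ∑ a, boolWeight p a = 1 := by simp [boolWeight]

lemma sum_pairWeight (p : ℝ) : ∑ a, pairWeight p a = 1 := by
  simp [Fintype.sum_prod_type, pairWeight, boolWeight]
  ring

lemma designExp_const (p b : unitInterval) (m : ℕ) (c : ℝ) :
    designExp p b m (fun _ _ => c) = c := by
  have h (G : SimpleGraph (Fin (2 * m))) : pmfExp (design b m G) (fun _ => c) = c := by
    rw [← integral_toMeasure]
    simp
  simp only [designExp, h]
  rw [← integral_binomialRandom p fun _ => c]
  simp

end designExp

/-! ### Moments of the increments -/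

section weights

variable (p : unitInterval)

lemma boolWeight_nonneg (a : Bool) : 0 ≤ boolWeight p a := by
  cases a
  · simpa [boolWeight] using p.2.2
  · simpa [boolWeight] using p.2.1

lemma pairWeight_nonneg (c : Bool × Bool) : 0 ≤ pairWeight p c :=
  mul_nonneg (boolWeight_nonneg p _) (boolWeight_nonneg p _)

lemma sum_diff (p : ℝ) : ∑ c, pairWeight p c * (ind c.1 - ind c.2) = 0 := by
  simp [Fintype.sum_prod_type, pairWeight, boolWeight]
  ring

lemma sum_diff_sq (p : ℝ) :
    ∑ c, pairWeight p c * (ind c.1 - ind c.2) ^ 2 = 2 * (p * (1 - p)) := by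
  simp [Fintype.sum_prod_type, pairWeight, boolWeight]
  ring

lemma sum_diff_pow_four (p : ℝ) :
    ∑ c, pairWeight p c * (ind c.1 - ind c.2) ^ 4 = 2 * (p * (1 - p)) := by
  simp [Fintype.sum_prod_type, pairWeight, boolWeight]
  ring

lemma sum_fst (p : ℝ) : ∑ c, pairWeight p c * (ind c.1 - p) = 0 := by
  simp [Fintype.sum_prod_type, pairWeight, boolWeight]
  ring

lemma sum_fst_sq (p : ℝ) : ∑ c, pairWeight p c * (ind c.1 - p) ^ 2 = p * (1 - p) := by
  simp [Fintype.sum_prod_type, pairWeight, boolWeight]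
  ring

lemma sum_snd (p : ℝ) : ∑ c, pairWeight p c * (ind c.2 - p) = 0 := by
  simp [Fintype.sum_prod_type, pairWeight, boolWeight]
  ring

lemma sum_snd_sq (p : ℝ) : ∑ c, pairWeight p c * (ind c.2 - p) ^ 2 = p * (1 - p) := by
  simp [Fintype.sum_prod_type, pairWeight, boolWeight]
  ring

lemma ind_sub_pow_four_le (c : Bool) : (ind c - (p : ℝ)) ^ 4 ≤ (ind c - (p : ℝ)) ^ 2 := by
  have h0 := p.2.1
  have h1 := p.2.2
  have : (ind c - (p : ℝ)) ^ 2 ≤ 1 := by cases c <;> simp only [ind_true, ind_false] <;> nlinarith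
  nlinarith [sq_nonneg (ind c - (p : ℝ))]

lemma sum_fst_pow_four : ∑ c, pairWeight p c * (ind c.1 - p) ^ 4 ≤ (p : ℝ) * (1 - p) :=
  sum_fst_sq p ▸ Finset.sum_le_sum fun c _ =>
    mul_le_mul_of_nonneg_left (ind_sub_pow_four_le p c.1) (pairWeight_nonneg p c)

lemma sum_snd_pow_four : ∑ c, pairWeight p c * (ind c.2 - p) ^ 4 ≤ (p : ℝ) * (1 - p) :=
  sum_snd_sq p ▸ Finset.sum_le_sum fun c _ =>
    mul_le_mul_of_nonneg_left (ind_sub_pow_four_le p c.2) (pairWeight_nonneg p c)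

lemma mul_one_sub_le : (p : ℝ) * (1 - p) ≤ 1 / 4 := by nlinarith [sq_nonneg ((p : ℝ) - 1 / 2)]

lemma mul_one_sub_nonneg : 0 ≤ (p : ℝ) * (1 - p) := mul_nonneg p.2.1 (sub_nonneg.2 p.2.2)

end weights

section edgeExp

variable {p : unitInterval} {k : ℕ} {f g : (Fin k → Bool × Bool) → Bool → ℝ}

lemma edgeExp_eq_sum (p : ℝ) (f : (Fin k → Bool × Bool) → Bool → ℝ) :
    edgeExp p k f = ∑ a, boolWeight p a * prodExp (pairWeight p) k fun ω => f ω a := by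
  simp only [edgeExp, prodExp_sum, prodExp_const_mul]

lemma edgeExp_add (p : ℝ) (f g : (Fin k → Bool × Bool) → Bool → ℝ) :
    edgeExp p k (fun ω a => f ω a + g ω a) = edgeExp p k f + edgeExp p k g := by
  simp only [edgeExp_eq_sum, prodExp_add, mul_add, Finset.sum_add_distrib]

lemma edgeExp_const_mul (p c : ℝ) (f : (Fin k → Bool × Bool) → Bool → ℝ) :
    edgeExp p k (fun ω a => c * f ω a) = c * edgeExp p k f := by
  simp only [edgeExp_eq_sum, prodExp_const_mul, Finset.mul_sum, mul_left_comm]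

lemma edgeExp_const (p c : ℝ) : edgeExp p k (fun _ _ => c) = c := by
  simp only [edgeExp_eq_sum, prodExp_const (sum_pairWeight p), ← Finset.sum_mul, sum_boolWeight,
    one_mul]

lemma edgeExp_mono (h : ∀ ω a, f ω a ≤ g ω a) : edgeExp p k f ≤ edgeExp p k g :=
  prodExp_mono (pairWeight_nonneg p) fun ω => Finset.sum_le_sum fun a _ =>
    mul_le_mul_of_nonneg_left (h ω a) (boolWeight_nonneg p a)

lemma edgeExp_le_of_forall {c : ℝ}
    (h : ∀ a, prodExp (pairWeight p) k (fun ω => f ω a) ≤ c) : edgeExp p k f ≤ c := by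
  rw [edgeExp_eq_sum]
  calc _ ≤ ∑ a, boolWeight (p : ℝ) a * c := Finset.sum_le_sum fun a _ =>
        mul_le_mul_of_nonneg_left (h a) (boolWeight_nonneg p a)
    _ = c := by rw [← Finset.sum_mul, sum_boolWeight, one_mul]

lemma le_edgeExp_of_forall {c : ℝ}
    (h : ∀ a, c ≤ prodExp (pairWeight p) k (fun ω => f ω a)) : c ≤ edgeExp p k f := by
  rw [edgeExp_eq_sum]
  calc c = ∑ a, boolWeight (p : ℝ) a * c := by rw [← Finset.sum_mul, sum_boolWeight, one_mul]
    _ ≤ _ := Finset.sum_le_sum fun a _ =>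
        mul_le_mul_of_nonneg_left (h a) (boolWeight_nonneg p a)

end edgeExp

section moments

variable (p : unitInterval) {k : ℕ} (H : SimpleGraph (Fin k)) (T : Fin k → Fin 2)

lemma sum_sgn_sq : ∑ i, sgn (T i) ^ 2 = k := by simp [sgn_sq]

lemma sum_sgn_mul_sub (hT : ∑ i, sgn (T i) = 0) (x : Fin k → ℝ) (c : ℝ) :
    ∑ i, sgn (T i) * (x i - c) = ∑ i, sgn (T i) * x i := by
  simp only [mul_sub, Finset.sum_sub_distrib, ← Finset.sum_mul, hT, zero_mul, sub_zero]

/-- The sum of squared differences contributes 2qk, and the two squared sums contribute variance qk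
each. -/
lemma edgeExp_commonTerm (hT : ∑ i, sgn (T i) = 0) :
    edgeExp p k (fun ω a => commonTerm T ω a) = 4 * ((p : ℝ) * (1 - p)) * k + 2 * (1 - p) := by
  have h1 := sum_pairWeight p
  have hu := prodExp_linear_sq h1 (sum_fst p) (sum_fst_sq p) fun i => sgn (T i)
  have hv := prodExp_linear_sq h1 (sum_snd p) (sum_snd_sq p) fun i => sgn (T i)
  have hd := prodExp_sum_apply (k := k) h1 fun c => (ind c.1 - ind c.2) ^ 2
  rw [sum_sgn_sq] at hu hv
  rw [sum_diff_sq] at hd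
  simp only [sum_sgn_mul_sub T hT] at hu hv
  have (a : Bool) : prodExp (pairWeight p) k (fun ω => commonTerm T ω a) =
      4 * ((p : ℝ) * (1 - p)) * k + 2 * (1 - ind a) ^ 2 := by
    simp only [commonTerm]
    rw [prodExp_add, prodExp_add, prodExp_add, prodExp_const h1, hu, hv, hd]
    ring
  simp only [edgeExp_eq_sum, this]
  simp [boolWeight]
  ring

/-- Young's inequality. The parameter stays free: η = 1 serves for error terms, while a small η
preserves the leading constant in the upper bound on the drift. -/
lemma sum_linCoeff_sq_le (a : Bool) {η : ℝ} (hη : 0 < η) :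
    ∑ i, linCoeff H T a i ^ 2 ≤ (1 + η) * imbalance H T ^ 2 + (1 + 1 / η) * k := by
  rw [imbalance_sq, ← sum_sgn_sq T, Finset.mul_sum, Finset.mul_sum, ← Finset.sum_add_distrib]
  refine Finset.sum_le_sum fun i _ => ?_
  rw [linCoeff]
  set x := imbalanceVec H T i
  set s := sgn (T i)
  have key : (1 + η) * x ^ 2 + (1 + 1 / η) * s ^ 2 - (x + s) ^ 2 = (η * x - s) ^ 2 / η := by
    field_simp
    ring
  have h2 : 0 ≤ (η * x - s) ^ 2 / η := by positivity
  have h3 : 0 ≤ (1 + 1 / η) * s ^ 2 := by positivity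
  cases a
  · simp only [ind_false, sub_zero, one_mul]
    linarith
  · simp only [ind_true, sub_self, zero_mul, add_zero]
    nlinarith [sq_nonneg x]

lemma edgeExp_crossTerm_sq_le {η : ℝ} (hη : 0 < η) :
    edgeExp p k (fun ω a => crossTerm H T ω a ^ 2) ≤
      2 * ((p : ℝ) * (1 - p)) * ((1 + η) * imbalance H T ^ 2 + (1 + 1 / η) * k) := by
  refine edgeExp_le_of_forall fun a => ?_
  have h := prodExp_linear_sq (w := pairWeight p) (ξ := fun c => ind c.1 - ind c.2)
    (v := 2 * ((p : ℝ) * (1 - p))) (sum_pairWeight p) (sum_diff p) (sum_diff_sq p)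
    (linCoeff H T a)
  refine h.le.trans ?_
  exact mul_le_mul_of_nonneg_left (sum_linCoeff_sq_le H T a hη)
    (by linarith [mul_one_sub_nonneg p])

/-- Triangle inequality: the correction to the imbalance vector has entries of modulus at most 1,
hence norm at most √k. -/
lemma imbalance_sub_sqrt_le (a : Bool) :
    imbalance H T - √k ≤ √(∑ i, linCoeff H T a i ^ 2) := by
  have h1 : imbalance H T = ‖WithLp.toLp 2 (imbalanceVec H T)‖ := rfl
  have h2 : √(∑ i, linCoeff H T a i ^ 2) = ‖WithLp.toLp 2 (linCoeff H T a)‖ := by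
    simp [EuclideanSpace.norm_eq]
  have h3 : ‖WithLp.toLp 2 (fun i => (1 - ind a) * sgn (T i))‖ ≤ √k := by
    rw [EuclideanSpace.norm_eq]
    refine Real.sqrt_le_sqrt ?_
    rw [← sum_sgn_sq T]
    refine Finset.sum_le_sum fun i _ => ?_
    cases a <;> simp [sgn_sq]
  have h4 : WithLp.toLp 2 (imbalanceVec H T) = WithLp.toLp 2 (linCoeff H T a) -
      WithLp.toLp 2 (fun i => (1 - ind a) * sgn (T i)) := by
    ext i; simp [linCoeff]
  rw [h1, h2, h4]
  have := norm_sub_le (WithLp.toLp 2 (linCoeff H T a))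
    (WithLp.toLp 2 (fun i => (1 - ind a) * sgn (T i)))
  linarith

lemma le_edgeExp_abs_crossTerm :
    5 / 4 * ((p : ℝ) * (1 - p)) * (imbalance H T - √k) ≤
      edgeExp p k fun ω a => |crossTerm H T ω a| := by
  refine le_edgeExp_of_forall fun a => ?_
  have h := le_prodExp_abs_linear (w := pairWeight p) (ξ := fun c => ind c.1 - ind c.2)
    (v := 2 * ((p : ℝ) * (1 - p))) (pairWeight_nonneg p) (sum_pairWeight p) (sum_diff p)
    (sum_diff_sq p) (sum_diff_pow_four p).le (by linarith [mul_one_sub_le p]) (linCoeff H T a)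
  refine le_trans ?_ h
  have := mul_le_mul_of_nonneg_left (imbalance_sub_sqrt_le H T a)
    (show 0 ≤ 5 / 4 * ((p : ℝ) * (1 - p)) by linarith [mul_one_sub_nonneg p])
  linarith

/-- Only the order k² matters. Beyond a part bounded by k + 2, `commonTerm` is a sum of two squares
of centred linear forms, with fourth moments at most (3/8)k². -/
lemma edgeExp_commonTerm_sq_le (hT : ∑ i, sgn (T i) = 0) :
    edgeExp p k (fun ω a => commonTerm T ω a ^ 2) ≤ 9 * ((k : ℝ) + 2) ^ 2 := by
  have h1 := sum_pairWeight p
  have hq := mul_one_sub_le p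
  have hu := prodExp_linear_pow_four (pairWeight_nonneg p) h1 (sum_fst p) (sum_fst_sq p)
    (sum_fst_pow_four p) (by linarith) fun i => sgn (T i)
  have hv := prodExp_linear_pow_four (pairWeight_nonneg p) h1 (sum_snd p) (sum_snd_sq p)
    (sum_snd_pow_four p) (by linarith) fun i => sgn (T i)
  rw [sum_sgn_sq] at hu hv
  simp only [sum_sgn_mul_sub T hT] at hu hv
  have bound (ω : Fin k → Bool × Bool) (a : Bool) : commonTerm T ω a ^ 2 ≤
      3 * ((k : ℝ) + 2) ^ 2 + 3 * (∑ i, sgn (T i) * ind (ω i).1) ^ 4 +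
        3 * (∑ i, sgn (T i) * ind (ω i).2) ^ 4 := by
    have hd : ∑ i, (ind (ω i).1 - ind (ω i).2) ^ 2 + 2 * (1 - ind a) ^ 2 ≤ (k : ℝ) + 2 := by
      refine add_le_add ?_ (by cases a <;> simp)
      calc _ ≤ ∑ _i : Fin k, (1 : ℝ) := Finset.sum_le_sum fun i _ => by
            rcases ω i with ⟨_ | _, _ | _⟩ <;> simp
        _ = k := by simp
    have hd0 : 0 ≤ ∑ i, (ind (ω i).1 - ind (ω i).2) ^ 2 + 2 * (1 - ind a) ^ 2 :=
      add_nonneg (Finset.sum_nonneg fun i _ => sq_nonneg _) (by positivity)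
    rw [commonTerm]
    set D := ∑ i, (ind (ω i).1 - ind (ω i).2) ^ 2
    set e := 2 * (1 - ind a) ^ 2
    set U := ∑ i, sgn (T i) * ind (ω i).1
    set V := ∑ i, sgn (T i) * ind (ω i).2
    have : (D + e) ^ 2 ≤ ((k : ℝ) + 2) ^ 2 := pow_le_pow_left₀ hd0 hd 2
    nlinarith [sq_nonneg (D + e - U ^ 2), sq_nonneg (D + e - V ^ 2), sq_nonneg (U ^ 2 - V ^ 2)]
  refine edgeExp_le_of_forall fun a => ?_
  refine (prodExp_mono (pairWeight_nonneg p) fun ω => bound ω a).trans ?_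
  rw [prodExp_add, prodExp_add, prodExp_const h1,
    prodExp_const_mul 3 fun ω : Fin k → Bool × Bool => (∑ i, sgn (T i) * ind (ω i).1) ^ 4,
    prodExp_const_mul 3 fun ω : Fin k → Bool × Bool => (∑ i, sgn (T i) * ind (ω i).2) ^ 4]
  have hk : (0 : ℝ) ≤ k := k.cast_nonneg
  nlinarith [sq_nonneg (k : ℝ)]

end moments

/-! ### One-step recursions for the second and fourth moments -/

section recursion

variable (p b : unitInterval) (m : ℕ)

/-- The `r`-th moment of the imbalance after `m` pairs. -/
def pairMoment (p b : unitInterval) (r m : ℕ) : ℝ :=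
  designExp p b m fun G T => imbalance G T ^ r

/-- The expected decrement of the squared imbalance. -/
def drift (p : ℝ) {k : ℕ} (H : SimpleGraph (Fin k)) (T : Fin k → Fin 2) : ℝ :=
  edgeExp p k fun ω a => |crossTerm H T ω a|

lemma pairMoment_two_succ : pairMoment p b 2 (m + 1) = pairMoment p b 2 m +
    8 * ((p : ℝ) * (1 - p)) * m + 2 * (1 - p) -
      2 * (2 * (b : ℝ) - 1) * designExp p b m fun H T => drift p H T := by
  have h : designExp p b m (fun H T => imbalance H T ^ 2 +
      ((8 * ((p : ℝ) * (1 - p)) * m + 2 * (1 - p)) + -(2 * (2 * (b : ℝ) - 1)) * drift p H T)) =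
      pairMoment p b 2 (m + 1) := by
    refine Eq.trans ?_ (designExp_succ p b m fun G T => imbalance G T ^ 2).symm
    refine designExp_congr fun H T hT => ?_
    rw [stepExp_imbalance_sq]
    simp only [sub_eq_add_neg, ← neg_mul]
    rw [edgeExp_add, edgeExp_add, edgeExp_const, edgeExp_commonTerm p T hT, edgeExp_const_mul,
      drift]
    push_cast
    ring
  rw [← h, designExp_add, designExp_add, designExp_const, designExp_const_mul]
  unfold pairMoment
  ring

lemma pairMoment_zero (r : ℕ) (hr : r ≠ 0) : pairMoment p b r 0 = 0 := by
  have : ∀ (G : SimpleGraph (Fin (2 * 0))) T, imbalance G T ^ r = 0 := fun G T => by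
    have h := imbalance_sq G T
    simp at h
    simp [h, hr]
  simp only [pairMoment, this]
  exact designExp_const p b 0 0

lemma pairMoment_nonneg (r : ℕ) : 0 ≤ pairMoment p b r m := by
  rw [← designExp_const p b m 0]
  exact designExp_mono fun G T _ => pow_nonneg (imbalance_nonneg G T) r

lemma drift_nonneg {k : ℕ} (H : SimpleGraph (Fin k)) (T : Fin k → Fin 2) : 0 ≤ drift p H T := by
  rw [← edgeExp_const (k := k) (p : ℝ) 0]
  exact edgeExp_mono fun ω a => abs_nonneg _

lemma pairMoment_four_succ_le (hb : 1 / 2 < (b : ℝ)) :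
    pairMoment p b 4 (m + 1) ≤ pairMoment p b 4 m +
      (16 * ((p : ℝ) * (1 - p)) * m + 8) * pairMoment p b 2 m + 44 * ((m : ℝ) + 1) ^ 2 -
        4 * (2 * (b : ℝ) - 1) * designExp p b m fun H T => imbalance H T ^ 2 * drift p H T := by
  have h : pairMoment p b 4 (m + 1) ≤ designExp p b m (fun H T => imbalance H T ^ 4 +
      ((16 * ((p : ℝ) * (1 - p)) * m + 8) * imbalance H T ^ 2 +
      (44 * ((m : ℝ) + 1) ^ 2 + -(4 * (2 * (b : ℝ) - 1)) * (imbalance H T ^ 2 * drift p H T)))) := by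
    refine (designExp_succ p b m fun G T => imbalance G T ^ 4).trans_le ?_
    refine designExp_mono fun H T hT => ?_
    rw [stepExp_imbalance_pow_four]
    have hβ : 0 ≤ 4 * (2 * (b : ℝ) - 1) := by linarith
    refine (edgeExp_mono (g := fun ω a => imbalance H T ^ 4 + (2 * imbalance H T ^ 2 *
      commonTerm T ω a + (commonTerm T ω a ^ 2 + (4 * crossTerm H T ω a ^ 2 +
      -(4 * (2 * (b : ℝ) - 1) * imbalance H T ^ 2) * |crossTerm H T ω a|)))) fun ω a => ?_).trans ?_
    -- The dropped summand -4β·`commonTerm`·|`crossTerm`| is nonpositive.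
    · have := mul_nonneg hβ (mul_nonneg (commonTerm_nonneg T ω a) (abs_nonneg (crossTerm H T ω a)))
      linarith
    rw [edgeExp_add, edgeExp_add, edgeExp_add, edgeExp_add, edgeExp_const, edgeExp_const_mul,
      edgeExp_const_mul, edgeExp_const_mul, edgeExp_commonTerm p T hT]
    have e1 := edgeExp_commonTerm_sq_le p T hT
    -- As q ≤ 1/4, this bounds 4·E[`crossTerm`²] by 4X² + 8m. Adding 4(1-p)X² gives the coefficient
    -- 8, and 36(m+1)² + 8m ≤ 44(m+1)².
    have e2 := edgeExp_crossTerm_sq_le p H T one_pos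
    have hq := mul_one_sub_le p
    have hX := sq_nonneg (imbalance H T)
    have hm : (0 : ℝ) ≤ m := m.cast_nonneg
    have e3 := mul_le_mul_of_nonneg_right hq (add_nonneg hX (mul_nonneg two_pos.le hm))
    have hp := mul_nonneg p.2.1 hX
    change _ + (_ + (_ + (_ + _ * drift p H T))) ≤ _
    push_cast at *
    nlinarith
  refine h.trans (le_of_eq ?_)
  rw [designExp_add, designExp_add, designExp_add, designExp_const, designExp_const_mul,
    designExp_const_mul]
  unfold pairMoment
  ring

end recursion

/-! ### Bounds on the second moment -/

section bounds

variable (p b : unitInterval)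

lemma designExp_drift_nonneg (m : ℕ) : 0 ≤ designExp p b m fun H T => drift p H T := by
  rw [← designExp_const p b m 0]
  exact designExp_mono fun H T _ => drift_nonneg p H T

lemma pairMoment_two_le (hb : 1 / 2 < (b : ℝ)) (m : ℕ) :
    pairMoment p b 2 m ≤ 4 * ((p : ℝ) * (1 - p)) * m ^ 2 + 2 * m := by
  induction m with
  | zero => simp [pairMoment_zero]
  | succ m ih =>
    rw [pairMoment_two_succ]
    have h1 := mul_nonneg (show 0 ≤ 2 * (2 * (b : ℝ) - 1) by linarith)
      (designExp_drift_nonneg p b m)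
    have h2 := mul_one_sub_nonneg p
    have h3 := p.2.1
    push_cast
    nlinarith

lemma pairMoment_two_half (m : ℕ) : pairMoment p half 2 m =
    4 * ((p : ℝ) * (1 - p)) * (m * (m - 1)) + 2 * (1 - p) * m := by
  induction m with
  | zero => simp [pairMoment_zero]
  | succ m ih =>
    rw [pairMoment_two_succ, ih, half_coe]
    push_cast
    ring

/-- Cauchy–Schwarz in linearised form: |z| ≤ z²/(2t) + t/2, with t later taken to be of the size of
the drift itself. -/
lemma drift_le {k : ℕ} (H : SimpleGraph (Fin k)) (T : Fin k → Fin 2) {η t : ℝ} (hη : 0 < η)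
    (ht : 0 < t) : drift p H T ≤ 1 / (2 * t) * (2 * ((p : ℝ) * (1 - p)) *
      ((1 + η) * imbalance H T ^ 2 + (1 + 1 / η) * k)) + t / 2 := by
  have h (z : ℝ) : |z| ≤ 1 / (2 * t) * z ^ 2 + t / 2 := by
    rw [← sq_abs z, ← sub_nonneg]
    have : 1 / (2 * t) * |z| ^ 2 + t / 2 - |z| = (|z| - t) ^ 2 / (2 * t) := by
      field_simp
      ring
    rw [this]
    positivity
  refine (edgeExp_mono fun ω a => h (crossTerm H T ω a)).trans ?_
  rw [edgeExp_add, edgeExp_const, edgeExp_const_mul]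
  gcongr
  exact edgeExp_crossTerm_sq_le p H T hη

lemma designExp_drift_le (m : ℕ) {η t : ℝ} (hη : 0 < η) (ht : 0 < t) :
    (designExp p b m fun H T => drift p H T) ≤ 1 / (2 * t) * (2 * ((p : ℝ) * (1 - p)) *
      ((1 + η) * pairMoment p b 2 m + (1 + 1 / η) * (2 * m))) + t / 2 := by
  have h : (designExp p b m fun H T => drift p H T) ≤ designExp p b m fun H T =>
      (1 / (2 * t) * (2 * ((p : ℝ) * (1 - p))) * (1 + η)) * imbalance H T ^ 2 +
      (1 / (2 * t) * (2 * ((p : ℝ) * (1 - p)) * ((1 + 1 / η) * (2 * m))) + t / 2) := by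
    refine designExp_mono fun H T _ => (drift_le p H T hη ht).trans (le_of_eq ?_)
    push_cast
    ring
  refine h.trans (le_of_eq ?_)
  rw [designExp_add, designExp_const, designExp_const_mul]
  unfold pairMoment
  ring

lemma designExp_drift_le_mul (hp0 : (0 : ℝ) < p) (hp1 : (p : ℝ) < 1) (hb : 1 / 2 < (b : ℝ)) :
    ∀ᶠ m : ℕ in atTop, (designExp p b m fun H T => drift p H T) ≤
      21 / 10 * √2 * ((p : ℝ) * (1 - p)) * m := by
  set q : ℝ := (p : ℝ) * (1 - p) with hq
  have hq0 : 0 < q := mul_pos hp0 (sub_pos.2 hp1)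
  -- With η = 1/20 the requirement is 8.4q²m² + 88.2qm ≤ 8.82q²m², that is, qm ≥ 210. The factor
  -- 21/10 relaxes the asymptotic 2.
  filter_upwards [eventually_ge_atTop ⌈210 / q⌉₊] with m hm
  have hm1 : 210 ≤ q * m := by
    have := (Nat.le_ceil _).trans (Nat.cast_le.2 hm)
    rwa [div_le_iff₀ hq0, mul_comm] at this
  have hm0 : (0 : ℝ) < m := by
    by_contra h
    nlinarith [m.cast_nonneg (α := ℝ)]
  set t := 21 / 10 * √2 * q * m with ht
  have ht0 : 0 < t := by positivity
  have h2 : t ^ 2 = (21 / 10) ^ 2 * 2 * q ^ 2 * m ^ 2 := by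
    rw [ht, mul_pow, mul_pow, mul_pow, Real.sq_sqrt two_pos.le]
  have h := designExp_drift_le p b m (η := 1 / 20) (by norm_num) ht0
  have hα := pairMoment_two_le p b hb m
  rw [← hq] at h hα
  have key : 2 * q * ((1 + 1 / 20) * pairMoment p b 2 m + (1 + 1 / (1 / 20)) * (2 * m)) ≤ t ^ 2 := by
    rw [h2]
    have e1 := mul_le_mul_of_nonneg_left hα hq0.le
    have e2 := mul_le_mul_of_nonneg_right hm1 (mul_pos hq0 hm0).le
    norm_num
    nlinarith
  have := mul_le_mul_of_nonneg_left key (show 0 ≤ 1 / (2 * t) by positivity)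
  have e : 1 / (2 * t) * t ^ 2 = t / 2 := by field_simp
  linarith

/-- The polynomial m²(m-1)² has increment exactly 4m³, so the sum telescopes with no lower-order
error and for either sign of `c`. -/
lemma le_of_eventually_succ {f : ℕ → ℝ} {c : ℝ}
    (h : ∀ᶠ m : ℕ in atTop, f (m + 1) ≤ f m + 4 * c * (m : ℝ) ^ 3) :
    ∃ K, ∀ᶠ m : ℕ in atTop, f m ≤ K + c * ((m : ℝ) ^ 2 * ((m : ℝ) - 1) ^ 2) := by
  obtain ⟨M, hM⟩ := eventually_atTop.1 h
  refine ⟨f M - c * ((M : ℝ) ^ 2 * ((M : ℝ) - 1) ^ 2), eventually_atTop.2 ⟨M, fun m hm => ?_⟩⟩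
  induction m, hm using Nat.le_induction with
  | base => linarith
  | succ m hm ih =>
    have := hM m hm
    push_cast
    nlinarith

lemma ge_of_eventually_succ {f : ℕ → ℝ} {c : ℝ}
    (h : ∀ᶠ m : ℕ in atTop, f m + 2 * c * m ≤ f (m + 1)) :
    ∃ K, ∀ᶠ m : ℕ in atTop, c * ((m : ℝ) * ((m : ℝ) - 1)) - K ≤ f m := by
  obtain ⟨M, hM⟩ := eventually_atTop.1 h
  refine ⟨c * ((M : ℝ) * ((M : ℝ) - 1)) - f M, eventually_atTop.2 ⟨M, fun m hm => ?_⟩⟩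
  induction m, hm using Nat.le_induction with
  | base => linarith
  | succ m hm ih =>
    have := hM m hm
    push_cast
    linarith

lemma eventually_le_natCast (x : ℝ) : ∀ᶠ m : ℕ in atTop, x ≤ m :=
  tendsto_natCast_atTop_atTop.eventually_ge_atTop x

lemma two_sub_pos : 0 < 2 - √2 * (2 * (b : ℝ) - 1) := by
  have h1 : √2 < 3 / 2 := by
    rw [Real.sqrt_lt' (by norm_num)]
    norm_num
  have h2 := b.2.2
  have h3 : (0 : ℝ) < √2 := by positivity
  nlinarith

lemma le_pairMoment_two (hp0 : (0 : ℝ) < p) (hp1 : (p : ℝ) < 1) (hb : 1 / 2 < (b : ℝ)) :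
    ∀ᶠ m : ℕ in atTop, 3 / 2 * ((2 - √2 * (2 * (b : ℝ) - 1)) * ((p : ℝ) * (1 - p))) * m ^ 2 ≤
      pairMoment p b 2 m := by
  set q : ℝ := (p : ℝ) * (1 - p) with hq
  have hq0 : 0 < q := mul_pos hp0 (sub_pos.2 hp1)
  set s := 2 - √2 * (2 * (b : ℝ) - 1) with hs
  have hs0 : 0 < s := two_sub_pos b
  have h2 : √2 < 3 / 2 := by
    rw [Real.sqrt_lt' (by norm_num)]
    norm_num
  have hb1 := b.2.2
  -- The increment of E X² is at least (8 - 4.2√2β)qm, which is at least 2·(8/5)(2-√2β)qm exactly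
  -- when √2β ≤ 8/5. Lowering 8/5 to 3/2 afterwards absorbs the lower-order terms.
  obtain ⟨K, hK⟩ := ge_of_eventually_succ (f := pairMoment p b 2) (c := 8 / 5 * (s * q)) (by
    filter_upwards [designExp_drift_le_mul p b hp0 hp1 hb] with m hm
    rw [pairMoment_two_succ, ← hq]
    rw [← hq] at hm
    have e1 := mul_le_mul_of_nonneg_left hm (show 0 ≤ 2 * (2 * (b : ℝ) - 1) by linarith)
    have e2 : √2 * (2 * (b : ℝ) - 1) ≤ 8 / 5 := by
      have : (2 * (b : ℝ) - 1) ≤ 1 := by linarith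
      nlinarith [Real.sqrt_nonneg 2]
    have e3 := mul_le_mul_of_nonneg_right e2 (mul_nonneg hq0.le (m.cast_nonneg (α := ℝ)))
    rw [hs]
    nlinarith)
  have hsq : 0 < s * q := mul_pos hs0 hq0
  filter_upwards [hK, eventually_le_natCast (32 : ℝ),
    eventually_le_natCast (K / (1 / 20 * (s * q)))] with m hm h32 hmK
  rw [div_le_iff₀ (by positivity)] at hmK
  nlinarith [mul_le_mul_of_nonneg_left h32 (mul_nonneg hsq.le (m.cast_nonneg (α := ℝ)))]

/-! ### Bounds on the fourth moment -/

lemma le_designExp_sq_mul_drift (m : ℕ) {τ : ℝ} (hτ : 0 ≤ τ) :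
    5 / 4 * ((p : ℝ) * (1 - p)) * (3 / 2 * τ * pairMoment p b 2 m - 1 / 2 * τ ^ 3 -
      √(2 * m) * pairMoment p b 2 m) ≤
      designExp p b m fun H T => imbalance H T ^ 2 * drift p H T := by
  set q : ℝ := (p : ℝ) * (1 - p) with hq
  have hq0 : 0 ≤ q := mul_one_sub_nonneg p
  have h : (designExp p b m fun H T => (5 / 4 * q * (3 / 2 * τ - √(2 * m))) * imbalance H T ^ 2 +
      -(5 / 4 * q * (1 / 2 * τ ^ 3))) ≤
      designExp p b m fun H T => imbalance H T ^ 2 * drift p H T := by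
    refine designExp_mono fun H T _ => ?_
    have h1 := mul_le_mul_of_nonneg_left (le_edgeExp_abs_crossTerm p H T)
      (sq_nonneg (imbalance H T))
    have h2 := imbalance_nonneg H T
    refine le_trans ?_ h1
    set X := imbalance H T
    -- The cubic lies above its tangent at τ: X³ - (3/2)τX² + τ³/2 = (X-τ)²(X+τ/2).
    have h3 : 0 ≤ 5 / 4 * q * ((X - τ) ^ 2 * (X + τ / 2)) := by positivity
    push_cast
    rw [← hq]
    nlinarith
  refine le_trans (le_of_eq ?_) h
  rw [designExp_add, designExp_const, designExp_const_mul]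
  unfold pairMoment
  ring

/-- Nonnegativity of the variance of the squared imbalance. -/
lemma sq_pairMoment_two_le (m : ℕ) : pairMoment p b 2 m ^ 2 ≤ pairMoment p b 4 m := by
  have h : (designExp p b m fun H T => (2 * pairMoment p b 2 m) * imbalance H T ^ 2 +
      -(pairMoment p b 2 m ^ 2)) ≤ designExp p b m fun H T => imbalance H T ^ 4 :=
    designExp_mono fun H T _ => by
      nlinarith [sq_nonneg (imbalance H T ^ 2 - pairMoment p b 2 m)]
  rw [designExp_add, designExp_const, designExp_const_mul] at h
  unfold pairMoment at *
  linarith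

/-- The gain of the adaptive design over random assignment. -/
def gain (p b : ℝ) : ℝ :=
  (2 * b - 1) * (p * (1 - p)) * √((2 - √2 * (2 * b - 1)) * (p * (1 - p))) ^ 3

lemma gain_pos (hp0 : (0 : ℝ) < p) (hp1 : (p : ℝ) < 1) (hb : 1 / 2 < (b : ℝ)) :
    0 < gain p b := by
  have h1 := mul_pos hp0 (sub_pos.2 hp1)
  have h2 := mul_pos (two_sub_pos b) h1
  have h3 : 0 < 2 * (b : ℝ) - 1 := by linarith
  unfold gain
  positivity

/-- The main term yields 9·`gain`·m³, while only 8 are claimed. The spare one pays 1/2 for the √(2m)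
loss in the drift and 1/2 for the quadratic errors. -/
lemma pairMoment_four_succ_le_gain (hp0 : (0 : ℝ) < p) (hp1 : (p : ℝ) < 1)
    (hb : 1 / 2 < (b : ℝ)) :
    ∀ᶠ m : ℕ in atTop, pairMoment p b 4 (m + 1) ≤ pairMoment p b 4 m +
      4 * (16 * ((p : ℝ) * (1 - p)) ^ 2 - 2 * gain p b) * (m : ℝ) ^ 3 := by
  have hY := gain_pos p b hp0 hp1 hb
  set Y := gain p b with hYdef
  set q : ℝ := (p : ℝ) * (1 - p) with hq
  have hq0 : 0 < q := mul_pos hp0 (sub_pos.2 hp1)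
  have hq4 : q ≤ 1 / 4 := mul_one_sub_le p
  have hsq : 0 < (2 - √2 * (2 * (b : ℝ) - 1)) * q := mul_pos (two_sub_pos b) hq0
  set β := 2 * (b : ℝ) - 1 with hβ
  have hβ0 : 0 < β := by linarith
  have hβ1 : β ≤ 1 := by linarith [b.2.2]
  set σ := √((2 - √2 * β) * q) with hσ
  have hσ0 : 0 < σ := Real.sqrt_pos.2 hsq
  have hσ2 : σ ^ 2 = (2 - √2 * β) * q := Real.sq_sqrt hsq.le
  have hY' : Y = β * q * σ ^ 3 := rfl
  filter_upwards [le_pairMoment_two p b hp0 hp1 hb, eventually_le_natCast 1,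
    eventually_le_natCast (416 / Y), eventually_le_natCast (113 / Y ^ 2)] with m hα hm1 hm2 hm3
  have hm0 : (0 : ℝ) ≤ m := by linarith
  rw [div_le_iff₀ hY] at hm2
  rw [div_le_iff₀ (by positivity)] at hm3
  rw [← hq, ← hβ, ← hσ2] at hα
  have hαle := pairMoment_two_le p b hb m
  have hα0 := pairMoment_nonneg p b m 2
  have hstep := pairMoment_four_succ_le p b m hb
  -- The best τ is √(E X²). The lower bound on E X² suggests √(3/2)·σm, and 61/50 approximates
  -- √(3/2) well enough to leave 9/5 out of (3/2)^(3/2).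
  have hd := le_designExp_sq_mul_drift p b m (τ := 61 / 50 * σ * m) (by positivity)
  rw [← hq] at hαle hstep hd
  rw [← hβ] at hstep
  set A := pairMoment p b 2 m
  set D := designExp p b m fun H T => imbalance H T ^ 2 * drift p H T
  clear_value A D σ β q Y
  have main : 9 / 5 * σ ^ 3 * (m : ℝ) ^ 3 ≤
      3 / 2 * (61 / 50 * σ * m) * A - 1 / 2 * (61 / 50 * σ * m) ^ 3 := by
    have := mul_le_mul_of_nonneg_left hα (show 0 ≤ 3 / 2 * (61 / 50 * σ * m) by positivity)
    have h3 : 0 ≤ σ ^ 3 * (m : ℝ) ^ 3 := by positivity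
    nlinarith
  have hsqrt : √(2 * m) ≤ 2 / 15 * Y * m := by
    refine Real.sqrt_le_iff.2 ⟨by positivity, ?_⟩
    nlinarith [mul_le_mul_of_nonneg_right hm3 hm0]
  have hA3 : A ≤ 3 * (m : ℝ) ^ 2 := by nlinarith [sq_nonneg (m : ℝ)]
  have err1 : √(2 * m) * A ≤ 2 / 5 * Y * (m : ℝ) ^ 3 := by
    calc _ ≤ (2 / 15 * Y * m) * (3 * (m : ℝ) ^ 2) := mul_le_mul hsqrt hA3 hα0 (by positivity)
      _ = _ := by ring
  have err2 : (16 * q * m + 8) * A ≤ 64 * q ^ 2 * (m : ℝ) ^ 3 + 32 * (m : ℝ) ^ 2 := by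
    have e1 := mul_le_mul_of_nonneg_left hαle (show 0 ≤ 16 * q * m + 8 by positivity)
    have e2 := mul_le_mul_of_nonneg_right hq4 (sq_nonneg (m : ℝ))
    have e3 := pow_le_pow_right₀ hm1 one_le_two
    linarith
  have err3 : 32 * (m : ℝ) ^ 2 + 44 * ((m : ℝ) + 1) ^ 2 ≤ 1 / 2 * Y * (m : ℝ) ^ 3 := by
    have e1 := mul_le_mul_of_nonneg_right hm2 (sq_nonneg (m : ℝ))
    have e2 : ((m : ℝ) + 1) ^ 2 ≤ (2 * m) ^ 2 := pow_le_pow_left₀ (by linarith) (by linarith) 2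
    linarith
  have hD : 5 / 4 * q * (9 / 5 * σ ^ 3 * (m : ℝ) ^ 3 - 2 / 5 * Y * (m : ℝ) ^ 3) ≤ D := by
    refine le_trans (mul_le_mul_of_nonneg_left ?_ (by positivity)) hd
    linarith
  have hD' := mul_le_mul_of_nonneg_left hD (show 0 ≤ 4 * β by positivity)
  have e4 : 4 * β * (5 / 4 * q * (9 / 5 * σ ^ 3 * (m : ℝ) ^ 3 - 2 / 5 * Y * (m : ℝ) ^ 3)) =
      9 * Y * (m : ℝ) ^ 3 - 2 * (β * q) * (Y * (m : ℝ) ^ 3) := by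
    rw [hY']
    ring
  have e5 : β * q ≤ 1 / 4 := (mul_le_of_le_one_left hq0.le hβ1).trans hq4
  have e6 := mul_le_mul_of_nonneg_right e5 (show 0 ≤ Y * (m : ℝ) ^ 3 by positivity)
  linarith

end bounds

/-! ### Passage to the limit -/

lemma tendsto_half_div : Tendsto (fun n : ℕ => ((n / 2 : ℕ) : ℝ) / n) atTop (𝓝 (1 / 2)) := by
  have h0 : Tendsto (fun n : ℕ => (1 : ℝ) / n) atTop (𝓝 0) := tendsto_one_div_atTop_nhds_zero_nat
  have h1 : Tendsto (fun n : ℕ => 1 / 2 - 1 / 2 * ((1 : ℝ) / n)) atTop (𝓝 (1 / 2)) := by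
    simpa using tendsto_const_nhds.sub (h0.const_mul (1 / 2 : ℝ))
  refine tendsto_of_tendsto_of_tendsto_of_le_of_le' h1 tendsto_const_nhds ?_ ?_
  · filter_upwards [eventually_gt_atTop 0] with n hn
    have hn' : (0 : ℝ) < n := Nat.cast_pos.2 hn
    rw [le_div_iff₀ hn']
    have : ((n : ℕ) : ℝ) ≤ 2 * ((n / 2 : ℕ) : ℝ) + 1 := by
      exact_mod_cast (by omega : n ≤ 2 * (n / 2) + 1)
    have e : (1 / 2 - 1 / 2 * ((1 : ℝ) / n)) * n = (n - 1) / 2 := by field_simp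
    rw [e]
    linarith
  · filter_upwards [eventually_gt_atTop 0] with n hn
    have hn' : (0 : ℝ) < n := Nat.cast_pos.2 hn
    rw [div_le_iff₀ hn']
    have : 2 * ((n / 2 : ℕ) : ℝ) ≤ n := by exact_mod_cast (by omega : 2 * (n / 2) ≤ n)
    linarith

lemma tendsto_quartic (K c : ℝ) : Tendsto (fun n : ℕ =>
    (K + c * (((n / 2 : ℕ) : ℝ) ^ 2 * (((n / 2 : ℕ) : ℝ) - 1) ^ 2)) / (n : ℝ) ^ 4) atTop
    (𝓝 (c / 16)) := by
  have h0 : Tendsto (fun n : ℕ => (1 : ℝ) / n) atTop (𝓝 0) := tendsto_one_div_atTop_nhds_zero_nat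
  have h := ((h0.pow 4).const_mul K).add
    (((tendsto_half_div.pow 2).mul ((tendsto_half_div.sub h0).pow 2)).const_mul c)
  have e : K * 0 ^ 4 + c * ((1 / 2) ^ 2 * (1 / 2 - 0) ^ 2) = c / 16 := by ring
  rw [e] at h
  refine h.congr' ?_
  filter_upwards [eventually_gt_atTop 0] with n hn
  have hn' : (n : ℝ) ≠ 0 := by positivity
  field_simp

lemma tendsto_quadratic (c d : ℝ) : Tendsto (fun n : ℕ =>
    (c * (((n / 2 : ℕ) : ℝ) * (((n / 2 : ℕ) : ℝ) - 1)) + d * ((n / 2 : ℕ) : ℝ)) / (n : ℝ) ^ 2) atTop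
    (𝓝 (c / 4)) := by
  have h0 : Tendsto (fun n : ℕ => (1 : ℝ) / n) atTop (𝓝 0) := tendsto_one_div_atTop_nhds_zero_nat
  have h := ((tendsto_half_div.mul (tendsto_half_div.sub h0)).const_mul c).add
    ((tendsto_half_div.mul h0).const_mul d)
  have e : c * (1 / 2 * (1 / 2 - 0)) + d * (1 / 2 * 0) = c / 4 := by ring
  rw [e] at h
  refine h.congr' ?_
  filter_upwards [eventually_gt_atTop 0] with n hn
  have hn' : (n : ℝ) ≠ 0 := by positivity
  field_simp

lemma tendsto_div_two : Tendsto (fun n : ℕ => n / 2) atTop atTop :=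
  Nat.tendsto_div_const_atTop two_ne_zero

/-- In `EReal` the limsup is monotone without any boundedness side condition. -/
lemma limsup_coe_le {f g : ℕ → ℝ} {L : ℝ} (h : ∀ᶠ n in atTop, f n ≤ g n)
    (hg : Tendsto g atTop (𝓝 L)) :
    limsup (fun n => (f n : EReal)) atTop ≤ (L : EReal) := by
  have hg' : Tendsto (fun n => (g n : EReal)) atTop (𝓝 (L : EReal)) :=
    (continuous_coe_real_ereal.tendsto L).comp hg
  rw [← hg'.limsup_eq]
  exact limsup_le_limsup (h.mono fun n hn => EReal.coe_le_coe_iff.2 hn)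

lemma gain_eq (p b : unitInterval) (hp0 : (0 : ℝ) < p) (hp1 : (p : ℝ) < 1) :
    gain p b = (2 * (b : ℝ) - 1) * (2 - √2 * (2 * (b : ℝ) - 1)) ^ (3 / 2 : ℝ) *
      (p : ℝ) ^ (5 / 2 : ℝ) * (1 - (p : ℝ)) ^ (5 / 2 : ℝ) := by
  have hs := two_sub_pos b
  have hp1' := sub_pos.2 hp1
  set s := 2 - √2 * (2 * (b : ℝ) - 1) with hsdef
  have h5 (x : ℝ) (hx : 0 < x) : x ^ (5 / 2 : ℝ) = x * x ^ (3 / 2 : ℝ) := by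
    rw [show (5 / 2 : ℝ) = 1 + 3 / 2 by norm_num, Real.rpow_add hx, Real.rpow_one]
  have h3 (x : ℝ) (hx : 0 ≤ x) : √x ^ 3 = x ^ (3 / 2 : ℝ) := by
    rw [Real.sqrt_eq_rpow, ← Real.rpow_natCast, ← Real.rpow_mul hx]
    norm_num
  rw [gain, ← hsdef, h3 _ (by positivity), h5 _ hp0, h5 _ hp1',
    Real.mul_rpow hs.le (by positivity), Real.mul_rpow hp0.le hp1'.le]
  ring

end

end AdaptiveNetwork

theorem theorem2 (p b : unitInterval) (hp0 : (0 : ℝ) < p) (hp1 : (p : ℝ) < 1)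
    (hb : (1 / 2 : ℝ) < b) :
    limsup (fun n : ℕ => ((AdaptiveNetwork.imbalanceMoment p b 4 n / (n : ℝ) ^ 4 : ℝ) : EReal)) atTop ≤
      (((p : ℝ) ^ 2 * (1 - (p : ℝ)) ^ 2 -
        1 / 8 * (2 * (b : ℝ) - 1) * (2 - √2 * (2 * (b : ℝ) - 1)) ^ (3 / 2 : ℝ) *
          (p : ℝ) ^ (5 / 2 : ℝ) * (1 - (p : ℝ)) ^ (5 / 2 : ℝ) : ℝ) : EReal) ∧
    limsup (fun n : ℕ => ((AdaptiveNetwork.imbalanceMoment p b 2 n / (n : ℝ) ^ 2 : ℝ) : EReal)) atTop <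
      (((p : ℝ) * (1 - (p : ℝ)) : ℝ) : EReal) ∧
    Tendsto (fun n : ℕ => AdaptiveNetwork.imbalanceMoment p AdaptiveNetwork.half 2 n / (n : ℝ) ^ 2) atTop
      (𝓝 ((p : ℝ) * (1 - (p : ℝ)))) := by
  have hmoment (b' : unitInterval) (r n : ℕ) : AdaptiveNetwork.imbalanceMoment p b' r n =
      AdaptiveNetwork.pairMoment p b' r (n / 2) := AdaptiveNetwork.imbalanceMoment_eq p b' r n
  have hgain := AdaptiveNetwork.gain_pos p b hp0 hp1 hb
  have hq0 : 0 < (p : ℝ) * (1 - p) := mul_pos hp0 (sub_pos.2 hp1)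
  obtain ⟨K, hK⟩ := AdaptiveNetwork.le_of_eventually_succ
    (AdaptiveNetwork.pairMoment_four_succ_le_gain p b hp0 hp1 hb)
  have hK' := AdaptiveNetwork.tendsto_div_two.eventually hK
  have hlim := AdaptiveNetwork.tendsto_quartic K
    (16 * ((p : ℝ) * (1 - p)) ^ 2 - 2 * AdaptiveNetwork.gain p b)
  have hL : (16 * ((p : ℝ) * (1 - p)) ^ 2 - 2 * AdaptiveNetwork.gain p b) / 16 =
      ((p : ℝ) * (1 - p)) ^ 2 - 1 / 8 * AdaptiveNetwork.gain p b := by ring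
  rw [hL] at hlim
  refine ⟨?_, ?_, ?_⟩
  · have hrhs : (p : ℝ) ^ 2 * (1 - (p : ℝ)) ^ 2 -
        1 / 8 * (2 * (b : ℝ) - 1) * (2 - √2 * (2 * (b : ℝ) - 1)) ^ (3 / 2 : ℝ) *
          (p : ℝ) ^ (5 / 2 : ℝ) * (1 - (p : ℝ)) ^ (5 / 2 : ℝ) =
        ((p : ℝ) * (1 - p)) ^ 2 - 1 / 8 * AdaptiveNetwork.gain p b := by
      rw [AdaptiveNetwork.gain_eq p b hp0 hp1]
      ring
    rw [hrhs]
    refine AdaptiveNetwork.limsup_coe_le ?_ hlim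
    filter_upwards [hK'] with n hn
    rw [hmoment]
    gcongr
  -- The second moment over n² is at most the square root of the fourth-moment bound, which tends to
  -- √(q² - `gain`/8) < q.
  · refine lt_of_le_of_lt (AdaptiveNetwork.limsup_coe_le ?_ hlim.sqrt) (EReal.coe_lt_coe_iff.2 ?_)
    · filter_upwards [hK'] with n hn
      rw [hmoment]
      refine Real.le_sqrt_of_sq_le ?_
      rw [div_pow, ← pow_mul]
      gcongr
      exact (AdaptiveNetwork.sq_pairMoment_two_le p b (n / 2)).trans hn
    · rw [Real.sqrt_lt' hq0]
      linarith
  · have h := AdaptiveNetwork.tendsto_quadratic (4 * ((p : ℝ) * (1 - p))) (2 * (1 - p))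
    rw [mul_div_cancel_left₀ _ four_ne_zero] at h
    refine h.congr fun n => ?_
    rw [hmoment, AdaptiveNetwork.pairMoment_two_half]
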